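/- Let $N\ge 1$, let $\Omega\subset\mathbb R^N$ be a non-empty bounded open set, and consider the quasilinear Dirichlet problem $$-\operatorname{div}\Big[\gamma\Big(\tfrac{u^2+|\nabla u|^2}{2}\Big)\nabla u\Big]+\gamma\Big(\tfrac{u^2+|\nabla u|^2}{2}\Big)u=\nu g(u)+h\ \text{ in }\Omega,\qquad u=0\ \text{ on }\partial\Omega. \tag{P}$$ Assume that: - $\gamma:[0,\infty)\to\mathbb R$ is continuous and there are constants $0<\gamma_{\min}\le\gamma_{\max}$ with $\gamma_{\min}\le\gamma(t)\le\gamma_{\max}$ for all $t\ge 0$; - with $\Gamma(t)=\int_0^t\gamma(s)\,ds$, the function $t\mapsto\Gamma(t^2)$ is convex on $[0,\infty)$; - $g:\mathbb R\to\mathbb R$ is continuous, $g(0)=0$, and $g(t)=o(t)$ as $t\to+\infty$; - $h\in L^2(\Omega)$ and $h\ge 0$ a.e. in $\Omega$. A weak solution of (P) is a function $u\in H^1_0(\Omega)$ such that, for all $v\in H^1_0(\Omega)$ (the integrals being well defined), $$\int_\Omega\gamma\Big(\tfrac{u^2+|\nabla u|^2}{2}\Big)(uv+\nabla u\cdot\nabla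 v)\,dx=\nu\int_\Omega g(u)v\,dx+\int_\Omega hv\,dx ;$$ it is non-negative if $u\ge0$ a.e. in $\Omega$, and nontrivial if it is not a.e. equal to $0$. Put $G(t)=\int_0^t g(s)\,ds$. Then: (i) If $h\not\equiv 0$, then for every $\nu>0$ problem (P) has a non-negative nontrivial weak solution. (ii) Let $h\equiv 0$. (a) If there is $t_0\in[0,\infty)$ with $G(t_0)>0$, then there is $\nu_1>0$ such that for every $\nu>\nu_1$ problem (P) has a non-negative nontrivial weak solution, which is moreover a global minimizer on $H^1_0(\Omega)$ of the energy $$\mathcal E(u)=\int_\Omega\Gamma\Big(\tfrac{u^2+|\nabla u|^2}{2}\Big)dx-\nu\int_\Omega G(\max\{u,0\})\,dx-\int_\Omega hu\,dx .$$ (b) If there is $C>0$ with $|g(t)|\le C|t|$ for all $t\in\mathbb R$, then there is $\nu_0>0$ such that for $0<\nu<\nu_0$ problem (P) has no nontrivial weak solution (of any sign). -/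

import Mathlib

open MeasureTheory Set Filter Asymptotics
open scoped ContDiff

noncomputable section

namespace Quasilinear

/-- `ℝ^N` with its Euclidean norm. -/
abbrev RN (N : ℕ) : Type := EuclideanSpace ℝ (Fin N)

/-- `φ ∈ C_c^∞(Ω)`. -/
structure IsTest {N : ℕ} (Ω : Set (RN N)) (φ : RN N → ℝ) : Prop where
  smooth : ContDiff ℝ ∞ φ
  compact : HasCompactSupport φ
  support_subset : tsupport φ ⊆ Ω

/-- `Du` is the weak (distributional) gradient of `u` in `Ω`. -/
def HasWeakGradient {N : ℕ} (Ω : Set (RN N)) (u : RN N → ℝ) (Du : RN N → RN N) : Prop :=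
  ∀ ψ : RN N → ℝ, IsTest Ω ψ →
    ∫ x in Ω, u x • gradient ψ x = - ∫ x in Ω, ψ x • Du x

/-- `u ∈ H^1(Ω)` with weak gradient `Du`. -/
structure IsH1 {N : ℕ} (Ω : Set (RN N)) (u : RN N → ℝ) (Du : RN N → RN N) : Prop where
  memLp : MemLp u 2 (volume.restrict Ω)
  memLp_grad : MemLp Du 2 (volume.restrict Ω)
  weakGradient : HasWeakGradient Ω u Du

/-- `u ∈ H^1_0(Ω)` with weak gradient `Du`: `u` lies in `H^1(Ω)`, in the closure of `C_c^∞(Ω)`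
for the `H^1` norm. -/
structure IsH10 {N : ℕ} (Ω : Set (RN N)) (u : RN N → ℝ) (Du : RN N → RN N) : Prop
    extends IsH1 Ω u Du where
  approx : ∀ ε : ENNReal, 0 < ε → ∃ φ : RN N → ℝ, IsTest Ω φ ∧
    eLpNorm (fun x => u x - φ x) 2 (volume.restrict Ω) ≤ ε ∧
    eLpNorm (fun x => Du x - gradient φ x) 2 (volume.restrict Ω) ≤ ε

/-- The primitive `t ↦ ∫_0^t k(s) ds`. -/
def primitive (k : ℝ → ℝ) (t : ℝ) : ℝ := ∫ s in (0 : ℝ)..t, k s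

/-- The density `γ((u² + |∇u|²)/2) (u v + ∇u · ∇v)` of the weak form of the operator. -/
def operatorDensity {N : ℕ} (γ : ℝ → ℝ) (u : RN N → ℝ) (Du : RN N → RN N)
    (v : RN N → ℝ) (Dv : RN N → RN N) (x : RN N) : ℝ :=
  γ ((u x ^ 2 + ‖Du x‖ ^ 2) / 2) * (u x * v x + inner ℝ (Du x) (Dv x))

/-- `u ∈ H^1_0(Ω)` is a weak solution of
`-div[γ((u² + |∇u|²)/2) ∇u] + γ((u² + |∇u|²)/2) u = f(u) + h` in `Ω`, `u = 0` on `∂Ω`.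
The integrals in the weak formulation are required to exist. -/
def IsWeakSolution {N : ℕ} (Ω : Set (RN N)) (γ f : ℝ → ℝ) (h : RN N → ℝ)
    (u : RN N → ℝ) : Prop :=
  ∃ Du : RN N → RN N, IsH10 Ω u Du ∧
    ∀ (v : RN N → ℝ) (Dv : RN N → RN N), IsH10 Ω v Dv →
      IntegrableOn (operatorDensity γ u Du v Dv) Ω ∧
      IntegrableOn (fun x => f (u x) * v x) Ω ∧
      IntegrableOn (fun x => h x * v x) Ω ∧
      ∫ x in Ω, operatorDensity γ u Du v Dv x
        = (∫ x in Ω, f (u x) * v x) + ∫ x in Ω, h x * v x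

/-- The energy `∫_Ω Γ((u² + |∇u|²)/2) - ∫_Ω F(u₊) - ∫_Ω h u`, with `Γ`, `F` the primitives of
`γ`, `f` vanishing at `0`. -/
def energy {N : ℕ} (Ω : Set (RN N)) (γ f : ℝ → ℝ) (h : RN N → ℝ)
    (u : RN N → ℝ) (Du : RN N → RN N) : ℝ :=
  (∫ x in Ω, primitive γ ((u x ^ 2 + ‖Du x‖ ^ 2) / 2))
    - (∫ x in Ω, primitive f (max (u x) 0)) - ∫ x in Ω, h x * u x

/-- `u` is a global minimizer of the energy on `H^1_0(Ω)`. -/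
def IsGlobalMinimizer {N : ℕ} (Ω : Set (RN N)) (γ f : ℝ → ℝ) (h : RN N → ℝ)
    (u : RN N → ℝ) : Prop :=
  ∃ Du : RN N → RN N, IsH10 Ω u Du ∧
    ∀ (w : RN N → ℝ) (Dw : RN N → RN N), IsH10 Ω w Dw →
      energy Ω γ f h u Du ≤ energy Ω γ f h w Dw

end Quasilinear

end

/-!
# Non-negative solutions of a quasilinear Dirichlet problem by minimization

A pair `(u, ∇u)` with `u ∈ H^1_0(Ω)` is treated as an element of the Hilbert space
`L²(Ω; ℝ × ℝ^N)`, and `H^1_0(Ω)` as the closed subspace `sobolevJets Ω` generated by the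
pairs `(φ, ∇φ)` with `φ` a test function. The coefficients are truncated: `γ` becomes
`γ(max t 0)` and `f = ν g` becomes `k(t) = f(max t 0)`. This changes neither the operator
(`operatorDensity_comp_max`) nor the energy, which sees `u` only through `max u 0` in its nonlinear
lower order term (`totalEnergy_comp_max`), and it makes `k` vanish on the negative axis and `o(t)` at both ends.

*Existence of a minimizer* (`exists_isMinimizer_totalEnergy`). As `t ↦ Γ(t²)` is convex and
non-decreasing on `[0, ∞)`, the principal part `U ↦ ∫ Γ(‖U‖²/2)` is convex and continuous on
`L²(Ω; ℝ × ℝ^N)`. By Rellich's theorem (`tendsto_fstL2`) the lower order terms are weakly continuous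
on bounded subsets of `H^1_0`, and the sublinearity of `k` makes the energy coercive. The direct
method (`exists_minimizer`) applies. Rellich's theorem reduces to test functions that tend weakly to
`0`: averages over a ball of radius `δ` tend to `0` pointwise and boundedly, and for test functions
they differ from the function by at most `δ ‖∇φ‖` in `L²`.

*The equation and the sign.* The energy is Gateaux differentiable, so a minimizer `u` solves the
weak equation with right-hand side `k(u) + h` (`euler_lagrange`). Testing it with `β(-u)`, for a
smooth non-decreasing `β` that vanishes exactly on `(-∞, 0]`, gives `u ≥ 0`
(`nonneg_of_euler_lagrange`), whence `k(u) = f(u)`. Using a smooth `β` in place of the negative part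
requires only the smooth chain rule in `H^1_0` (`IsH10.comp`).

*Nontriviality.* If `u = 0` is a solution, testing the equation with `u` gives `∇u = 0`, and then
`∫ h ψ = 0` for all test functions `ψ`, so `h = 0`. If `h = 0` and `G(t₀) > 0`, a test function `φ`
with `∫ G(φ) > 0` has negative energy for large `ν`, so the minimizer is not `0`. If
`|g(t)| ≤ C |t|`, testing the equation with the solution itself shows that
`(γmin - ν C) ∫ u² ≤ 0`, so that every solution vanishes for `ν < γmin / C`.
-/

open Topology

noncomputable section

namespace Quasilinear

/-! ### Weak convergence and the direct method in Hilbert spaces -/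

section Hilbert

variable {H : Type*} [NormedAddCommGroup H] [InnerProductSpace ℝ H]

/-- Weak convergence of a sequence in a Hilbert space, tested against inner products. -/
def WeakTendsto (u : ℕ → H) (l : H) : Prop :=
  ∀ w : H, Tendsto (fun n => inner ℝ w (u n)) atTop (𝓝 (inner ℝ w l))

/-- Bounded sequences have weakly convergent subsequences (sequential Banach–Alaoglu, transported
by the Riesz isomorphism). -/
theorem exists_weakTendsto_subseq [CompleteSpace H] [TopologicalSpace.SeparableSpace H]
    {u : ℕ → H} {M : ℝ} (hM : ∀ n, ‖u n‖ ≤ M) :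
    ∃ (l : H) (φ : ℕ → ℕ), StrictMono φ ∧ WeakTendsto (u ∘ φ) l := by
  have hc := WeakDual.isSeqCompact_closedBall ℝ H (0 : StrongDual ℝ H) M
  obtain ⟨L, -, φ, hφ, hL⟩ := hc (x := fun n =>
    StrongDual.toWeakDual (InnerProductSpace.toDual ℝ H (u n))) (fun n => by
      simpa using hM n)
  refine ⟨(InnerProductSpace.toDual ℝ H).symm (WeakDual.toStrongDual L), φ, hφ, fun w => ?_⟩
  have h1 := ((WeakDual.eval_continuous w).tendsto L).comp hL
  have e1 : inner ℝ w ((InnerProductSpace.toDual ℝ H).symm (WeakDual.toStrongDual L)) = L w := by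
    rw [real_inner_comm, InnerProductSpace.toDual_symm_apply]; rfl
  rw [e1]
  refine h1.congr fun n => ?_
  rw [real_inner_comm]
  rfl

/-- Closed convex sets are weakly sequentially closed (Mazur, by Hahn–Banach separation). -/
theorem WeakTendsto.mem_of_convex [CompleteSpace H] {u : ℕ → H} {l : H} (h : WeakTendsto u l)
    {C : Set H} (hC : Convex ℝ C) (hC' : IsClosed C) (hu : ∀ᶠ n in atTop, u n ∈ C) : l ∈ C := by
  by_contra hl
  obtain ⟨f, s, hs, hsl⟩ := geometric_hahn_banach_closed_point hC hC' hl
  have h1 := h ((InnerProductSpace.toDual ℝ H).symm f)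
  simp only [InnerProductSpace.toDual_symm_apply] at h1
  have : f l ≤ s := le_of_tendsto h1 (hu.mono fun n hn => (hs _ hn).le)
  linarith

/-- The direct method: a coercive sum of a continuous convex functional and a weakly sequentially
continuous one attains its minimum on a closed convex set. -/
theorem exists_minimizer [CompleteSpace H] [TopologicalSpace.SeparableSpace H]
    {K : Set H} (hK : Convex ℝ K) (hKc : IsClosed K) (hne : K.Nonempty)
    {J₁ J₂ : H → ℝ} (hJ : ConvexOn ℝ univ J₁) (hJc : Continuous J₁)
    (hJ₂ : ∀ (u : ℕ → H) (l : H) (M : ℝ), (∀ n, u n ∈ K) → (∀ n, ‖u n‖ ≤ M) → WeakTendsto u l →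
      l ∈ K → Tendsto (fun n => J₂ (u n)) atTop (𝓝 (J₂ l)))
    {c C : ℝ} (hc : 0 < c) (hcoer : ∀ U ∈ K, c * ‖U‖ ^ 2 - C ≤ J₁ U + J₂ U) :
    ∃ U ∈ K, ∀ V ∈ K, J₁ U + J₂ U ≤ J₁ V + J₂ V := by
  set J : H → ℝ := fun U => J₁ U + J₂ U with hJdef
  have hbdd : BddBelow (J '' K) := by
    refine ⟨-C, ?_⟩
    rintro _ ⟨U, hU, rfl⟩
    have := hcoer U hU
    simp only [hJdef]
    nlinarith [sq_nonneg ‖U‖]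
  set m := sInf (J '' K) with hm
  have hseq : ∀ n : ℕ, ∃ U ∈ K, J U < m + 1 / ((n : ℝ) + 1) := by
    intro n
    obtain ⟨_, ⟨U, hU, rfl⟩, hlt⟩ := exists_lt_of_csInf_lt (hne.image J)
      (lt_add_of_pos_right m (by positivity : (0:ℝ) < 1 / ((n : ℝ) + 1)))
    exact ⟨U, hU, hlt⟩
  choose u huK hu using hseq
  have hlim : Tendsto (fun n : ℕ => m + 1 / ((n : ℝ) + 1)) atTop (𝓝 m) := by
    simpa using tendsto_const_nhds.add (tendsto_one_div_add_atTop_nhds_zero_nat (𝕜 := ℝ))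
  have hbound : ∀ n, ‖u n‖ ≤ (m + 1 + C) / c + 1 := by
    intro n
    have h1 := hcoer _ (huK n)
    have h2 := hu n
    have h3 : 1 / ((n : ℝ) + 1) ≤ 1 := by
      rw [div_le_one (by positivity)]; linarith [Nat.cast_nonneg (α := ℝ) n]
    have h4 : c * ‖u n‖ ^ 2 ≤ m + 1 + C := by simp only [hJdef] at h2; linarith
    have h5 : ‖u n‖ ^ 2 ≤ (m + 1 + C) / c := by rw [le_div_iff₀ hc]; linarith
    nlinarith [sq_nonneg (‖u n‖ - 1)]
  obtain ⟨l, φ, hφ, hw⟩ := exists_weakTendsto_subseq hbound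
  have hlK : l ∈ K := hw.mem_of_convex hK hKc (Eventually.of_forall fun n => huK _)
  have h2 := hJ₂ _ l _ (fun n => huK (φ n)) (fun n => hbound (φ n)) hw hlK
  have hle : J l ≤ m := by
    refine le_of_forall_pos_le_add fun ε hε => ?_
    have h3 : Tendsto (fun n => m + 1 / ((φ n : ℝ) + 1) - J₂ (u (φ n))) atTop (𝓝 (m - J₂ l)) :=
      (hlim.comp hφ.tendsto_atTop).sub h2
    have h4 : ∀ᶠ n in atTop, (u ∘ φ) n ∈ {U | U ∈ univ ∧ J₁ U ≤ m - J₂ l + ε} := by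
      filter_upwards [h3.eventually_lt_const (show m - J₂ l < m - J₂ l + ε by linarith)] with n hn
      have := hu (φ n)
      simp only [hJdef] at this
      refine ⟨mem_univ _, ?_⟩
      simp only [Function.comp]
      linarith
    have h5 := hw.mem_of_convex (hJ.convex_le (m - J₂ l + ε))
      (by simpa using isClosed_le hJc continuous_const) h4
    have := h5.2
    simp only [hJdef]; linarith
  exact ⟨l, hlK, fun V hV => hle.trans (csInf_le hbdd ⟨V, hV, rfl⟩)⟩

end Hilbert

/-! ### The space `H^1_0` as a closed subspace of `L²(Ω; ℝ × ℝ^N)` -/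

variable {N : ℕ} {Ω : Set (RN N)}

/-- The target `ℝ × ℝ^N`, with its Euclidean norm, of the pair `(u, ∇u)`. -/
abbrev Jet (N : ℕ) : Type := WithLp 2 (ℝ × RN N)

/-- The map `x ↦ (u x, Du x)`. -/
def jet (u : RN N → ℝ) (Du : RN N → RN N) (x : RN N) : Jet N := WithLp.toLp 2 (u x, Du x)

@[simp] theorem jet_fst (u : RN N → ℝ) (Du : RN N → RN N) (x : RN N) :
    (jet u Du x).fst = u x := rfl

@[simp] theorem jet_snd (u : RN N → ℝ) (Du : RN N → RN N) (x : RN N) :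
    (jet u Du x).snd = Du x := rfl

theorem Jet.inner_eq (z w : Jet N) :
    inner ℝ z w = z.fst * w.fst + inner ℝ z.snd w.snd := by
  rw [WithLp.prod_inner_apply]
  simp [mul_comm]

theorem Jet.norm_sq_eq (z : Jet N) : ‖z‖ ^ 2 = z.fst ^ 2 + ‖z.snd‖ ^ 2 := by
  rw [WithLp.prod_norm_sq_eq_of_L2]; simp

theorem Jet.norm_le_add (z : Jet N) : ‖z‖ ≤ ‖z.fst‖ + ‖z.snd‖ := by
  refine abs_le_of_sq_le_sq' ?_ (by positivity) |>.2
  rw [Jet.norm_sq_eq]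
  have : z.fst ^ 2 = ‖z.fst‖ ^ 2 := by simp
  rw [this]
  nlinarith [norm_nonneg z.fst, norm_nonneg z.snd]

theorem memLp_jet {μ : Measure (RN N)} {p : ENNReal} {u : RN N → ℝ} {Du : RN N → RN N}
    (hu : MemLp u p μ) (hDu : MemLp Du p μ) : MemLp (jet u Du) p μ :=
  MemLp.of_fst_of_snd_prodLp ⟨hu, hDu⟩

theorem eLpNorm_jet_le {μ : Measure (RN N)} {u : RN N → ℝ} {Du : RN N → RN N}
    (hu : AEStronglyMeasurable u μ) (hDu : AEStronglyMeasurable Du μ) :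
    eLpNorm (jet u Du) 2 μ ≤ eLpNorm u 2 μ + eLpNorm Du 2 μ := by
  have h1 : eLpNorm (jet u Du) 2 μ ≤ eLpNorm (fun x => ‖u x‖ + ‖Du x‖) 2 μ := by
    refine eLpNorm_mono fun x => ?_
    rw [Real.norm_of_nonneg (by positivity)]
    exact Jet.norm_le_add _
  refine h1.trans ((eLpNorm_add_le hu.norm hDu.norm (by norm_num)).trans ?_)
  rw [eLpNorm_norm, eLpNorm_norm]

theorem inner_gradient_eq_fderiv (φ : RN N → ℝ) (x e : RN N) :
    inner ℝ (gradient φ x) e = fderiv ℝ φ x e := by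
  simp [gradient]

theorem norm_gradient (φ : RN N → ℝ) (x : RN N) : ‖gradient φ x‖ = ‖fderiv ℝ φ x‖ := by
  simp [gradient]

namespace IsTest

variable {φ ψ : RN N → ℝ}

theorem continuous (h : IsTest Ω φ) : Continuous φ := h.smooth.continuous

theorem differentiable (h : IsTest Ω φ) : Differentiable ℝ φ :=
  h.smooth.differentiable (by simp)

theorem continuous_gradient (h : IsTest Ω φ) : Continuous (gradient φ) :=
  (InnerProductSpace.toDual ℝ (RN N)).symm.continuous.comp (h.smooth.continuous_fderiv (by simp))

theorem hasCompactSupport_gradient (h : IsTest Ω φ) : HasCompactSupport (gradient φ) :=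
  (h.compact.fderiv (𝕜 := ℝ)).comp_left
    (g := (InnerProductSpace.toDual ℝ (RN N)).symm) (map_zero _)

theorem memLp (h : IsTest Ω φ) (p : ENNReal) : MemLp φ p volume :=
  h.continuous.memLp_of_hasCompactSupport h.compact

theorem memLp_gradient (h : IsTest Ω φ) (p : ENNReal) : MemLp (gradient φ) p volume :=
  h.continuous_gradient.memLp_of_hasCompactSupport h.hasCompactSupport_gradient

theorem memLp_jet (h : IsTest Ω φ) (p : ENNReal) : MemLp (jet φ (gradient φ)) p volume :=
  Quasilinear.memLp_jet (h.memLp p) (h.memLp_gradient p)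

theorem eq_zero_of_notMem (h : IsTest Ω φ) {x : RN N} (hx : x ∉ Ω) : φ x = 0 :=
  image_eq_zero_of_notMem_tsupport fun hx' => hx (h.support_subset hx')

theorem gradient_eq_zero_of_notMem (h : IsTest Ω φ) {x : RN N} (hx : x ∉ Ω) :
    gradient φ x = 0 := by
  have : fderiv ℝ φ x = 0 := by
    have h1 := support_fderiv_subset ℝ (f := φ)
    by_contra h2
    exact hx (h.support_subset (h1 h2))
  simp [gradient, this]

theorem zero : IsTest Ω (fun _ => 0) :=
  ⟨contDiff_const, HasCompactSupport.zero, by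
    have : tsupport (fun _ : RN N => (0 : ℝ)) = ∅ := by simp
    rw [this]; exact empty_subset _⟩

theorem add (h : IsTest Ω φ) (h' : IsTest Ω ψ) : IsTest Ω (fun x => φ x + ψ x) :=
  ⟨h.smooth.add h'.smooth, h.compact.add h'.compact,
    (tsupport_add φ ψ).trans (union_subset h.support_subset h'.support_subset)⟩

theorem const_mul (c : ℝ) (h : IsTest Ω φ) : IsTest Ω (fun x => c * φ x) :=
  ⟨contDiff_const.mul h.smooth, h.compact.mul_left,
    (tsupport_mul_subset_right (f := fun _ => c) (g := φ)).trans h.support_subset⟩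

theorem gradient_add (h : IsTest Ω φ) (h' : IsTest Ω ψ) (x : RN N) :
    gradient (fun x => φ x + ψ x) x = gradient φ x + gradient ψ x := by
  have : fderiv ℝ (fun x => φ x + ψ x) x = fderiv ℝ φ x + fderiv ℝ ψ x :=
    fderiv_add (h.differentiable x) (h'.differentiable x)
  simp [gradient, this]

theorem gradient_const_mul (c : ℝ) (h : IsTest Ω φ) (x : RN N) :
    gradient (fun x => c * φ x) x = c • gradient φ x := by
  have : fderiv ℝ (fun x => c * φ x) x = c • fderiv ℝ φ x :=
    fderiv_const_mul (h.differentiable x) c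
  simp [gradient, this]

/-- Post-composition with a smooth function vanishing at `0` preserves test functions. -/
theorem comp {β : ℝ → ℝ} (hβ : ContDiff ℝ ∞ β) (hβ0 : β 0 = 0) (h : IsTest Ω φ) :
    IsTest Ω (fun x => β (φ x)) :=
  ⟨hβ.comp h.smooth, h.compact.comp_left hβ0,
    (closure_mono (Function.support_comp_subset hβ0 φ)).trans h.support_subset⟩

theorem gradient_comp {β : ℝ → ℝ} (hβ : ContDiff ℝ ∞ β) (h : IsTest Ω φ) (x : RN N) :
    gradient (fun x => β (φ x)) x = deriv β (φ x) • gradient φ x := by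
  have h1 : HasDerivAt β (deriv β (φ x)) (φ x) :=
    (hβ.differentiable (by simp) _).hasDerivAt
  have := (h1.comp_hasFDerivAt x (h.differentiable x).hasFDerivAt).fderiv
  have h2 : fderiv ℝ (fun x => β (φ x)) x = deriv β (φ x) • fderiv ℝ φ x := this
  simp [gradient, h2]

theorem integrable_mul (h : IsTest Ω φ) {u : RN N → ℝ} (hu : Continuous u) :
    Integrable (fun x => φ x * u x) :=
  (h.continuous.mul hu).integrable_of_hasCompactSupport h.compact.mul_right

/-- Integration by parts for test functions. -/
theorem integral_parts (h : IsTest Ω φ) (h' : IsTest Ω ψ) (e : RN N) :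
    ∫ x in Ω, (inner ℝ (gradient ψ x) e * φ x + ψ x * inner ℝ e (gradient φ x)) = 0 := by
  rw [setIntegral_eq_integral_of_forall_compl_eq_zero
    (fun x hx => by simp [h.eq_zero_of_notMem hx, h'.eq_zero_of_notMem hx])]
  simp_rw [real_inner_comm _ e, inner_gradient_eq_fderiv]
  have c1 : Continuous fun x => fderiv ℝ ψ x e :=
    (h'.smooth.continuous_fderiv (by simp)).clm_apply continuous_const
  have c2 : Continuous fun x => fderiv ℝ φ x e :=
    (h.smooth.continuous_fderiv (by simp)).clm_apply continuous_const
  have i1 : Integrable (fun x => fderiv ℝ ψ x e * φ x) := by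
    simpa [mul_comm] using h.integrable_mul c1
  have i2 := h'.integrable_mul c2
  have := integral_mul_fderiv_eq_neg_fderiv_mul_of_integrable (μ := (volume : Measure (RN N)))
    (v := e) i1 i2 (h'.integrable_mul h.continuous)
    (fun x _ => h'.differentiable x) (fun x _ => h.differentiable x)
  rw [integral_add i1 i2, this]
  ring

end IsTest

/-- The Hilbert space `L²(Ω; ℝ × ℝ^N)`. -/
abbrev JetL2 (Ω : Set (RN N)) : Type := Lp (Jet N) 2 (volume.restrict Ω)

instance : TopologicalSpace.SeparableSpace (JetL2 Ω) := by
  have : Fact ((2 : ENNReal) ≠ ⊤) := ⟨by simp⟩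
  have := Lp.SecondCountableTopology (p := 2) (μ := (volume : Measure (RN N)).restrict Ω)
    (E := Jet N)
  infer_instance

/-- The pairs `(φ, ∇φ)` with `φ ∈ C_c^∞(Ω)`, as a subspace of `L²(Ω; ℝ × ℝ^N)`. -/
def testJets (Ω : Set (RN N)) : Submodule ℝ (JetL2 Ω) where
  carrier := {U | ∃ φ, IsTest Ω φ ∧ U =ᵐ[volume.restrict Ω] jet φ (gradient φ)}
  zero_mem' := by
    refine ⟨_, IsTest.zero, ?_⟩
    filter_upwards [Lp.coeFn_zero (Jet N) 2 (volume.restrict Ω)] with x hx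
    rw [hx]
    have : gradient (fun _ : RN N => (0 : ℝ)) x = 0 := by simp [gradient]
    rw [jet, this]
    rfl
  add_mem' := by
    rintro U V ⟨φ, hφ, hU⟩ ⟨ψ, hψ, hV⟩
    refine ⟨_, hφ.add hψ, ?_⟩
    filter_upwards [Lp.coeFn_add U V, hU, hV] with x h1 h2 h3
    rw [h1, Pi.add_apply, h2, h3]
    simp only [jet, hφ.gradient_add hψ]
    rfl
  smul_mem' := by
    rintro c U ⟨φ, hφ, hU⟩
    refine ⟨_, hφ.const_mul c, ?_⟩
    filter_upwards [Lp.coeFn_smul c U, hU] with x h1 h2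
    rw [h1, Pi.smul_apply, h2]
    simp only [jet, hφ.gradient_const_mul c]
    rfl

/-- `H^1_0(Ω)`, realised as the closure in `L²(Ω; ℝ × ℝ^N)` of the pairs `(φ, ∇φ)`. -/
def sobolevJets (Ω : Set (RN N)) : Submodule ℝ (JetL2 Ω) := (testJets Ω).topologicalClosure

theorem IsTest.toLp_mem {φ : RN N → ℝ} (h : IsTest Ω φ) :
    ((h.memLp_jet 2).restrict Ω).toLp ∈ testJets Ω :=
  ⟨φ, h, MemLp.coeFn_toLp _⟩

/-- Elements of the closure lie in `H^1_0`. The weak gradient comes for free: integration by parts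
against a fixed test function `ψ` and direction `e` says that the pair is orthogonal to
`(∂ₑψ, ψ e)`, a closed condition that holds for test functions. -/
theorem isH10_of_mem_sobolevJets {u : RN N → ℝ} {Du : RN N → RN N} {U : JetL2 Ω}
    (hU : U ∈ sobolevJets Ω) (hUu : U =ᵐ[volume.restrict Ω] jet u Du) : IsH10 Ω u Du := by
  have hmem : MemLp (jet u Du) 2 (volume.restrict Ω) := (memLp_congr_ae hUu).1 (Lp.memLp U)
  have hu : MemLp u 2 (volume.restrict Ω) := hmem.prodLp_fst
  have hDu : MemLp Du 2 (volume.restrict Ω) := hmem.prodLp_snd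
  refine { memLp := hu, memLp_grad := hDu, weakGradient := ?_, approx := ?_ }
  · intro ψ hψ
    have i1 : Integrable (fun x => u x • gradient ψ x) (volume.restrict Ω) :=
      memLp_one_iff_integrable.1 (((hψ.memLp_gradient 2).restrict Ω).smul hu)
    have i2 : Integrable (fun x => ψ x • Du x) (volume.restrict Ω) :=
      memLp_one_iff_integrable.1 (hDu.smul ((hψ.memLp 2).restrict Ω))
    refine ext_inner_left ℝ fun e => ?_
    rw [inner_neg_right, ← integral_inner i1, ← integral_inner i2]
    have hP : MemLp (jet (fun x => inner ℝ (gradient ψ x) e) (fun x => ψ x • e)) 2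
        (volume.restrict Ω) := by
      refine Quasilinear.memLp_jet (((hψ.memLp_gradient 2).restrict Ω).inner_const e) ?_
      exact ((ContinuousLinearMap.id ℝ ℝ).smulRight e).comp_memLp' ((hψ.memLp 2).restrict Ω)
    have key : ∀ V ∈ sobolevJets Ω, inner ℝ hP.toLp V = 0 := by
      have hcl : IsClosed {V : JetL2 Ω | inner ℝ hP.toLp V = 0} :=
        isClosed_eq (by fun_prop) continuous_const
      refine fun V hV => closure_minimal ?_ hcl hV
      rintro V ⟨φ, hφ, hV⟩
      rw [mem_ofPred_eq, L2.inner_def, ← hφ.integral_parts hψ e]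
      refine integral_congr_ae ?_
      filter_upwards [hV, hP.coeFn_toLp] with x h1 h2
      rw [h1, h2, Jet.inner_eq]
      simp
    have h0 := key U hU
    rw [L2.inner_def] at h0
    have h1 : ∫ x in Ω, (inner ℝ e (u x • gradient ψ x) + inner ℝ e (ψ x • Du x)) = 0 := by
      rw [← h0]
      refine integral_congr_ae ?_
      filter_upwards [hUu, hP.coeFn_toLp] with x h1 h2
      rw [h1, h2, Jet.inner_eq]
      simp [inner_smul_left, inner_smul_right, mul_comm]
    rw [integral_add (i1.const_inner e) (i2.const_inner e)] at h1
    linarith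
  · intro ε hε
    obtain ⟨Φ, ⟨φ, hφ, hΦ⟩, hlt⟩ := EMetric.mem_closure_iff.1 hU ε hε
    rw [Lp.edist_def] at hlt
    have hae : (⇑U - ⇑Φ) =ᵐ[volume.restrict Ω]
        jet (fun x => u x - φ x) (fun x => Du x - gradient φ x) := by
      filter_upwards [hUu, hΦ] with x h1 h2
      rw [Pi.sub_apply, h1, h2]; rfl
    rw [eLpNorm_congr_ae hae] at hlt
    refine ⟨φ, hφ, (eLpNorm_mono fun x => ?_).trans hlt.le, (eLpNorm_mono fun x => ?_).trans hlt.le⟩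
    · exact WithLp.norm_fst_le (x := jet (fun x => u x - φ x) (fun x => Du x - gradient φ x) x)
    · exact WithLp.norm_snd_le (x := jet (fun x => u x - φ x) (fun x => Du x - gradient φ x) x)

theorem IsH10.memLp_jet {u : RN N → ℝ} {Du : RN N → RN N} (h : IsH10 Ω u Du) :
    MemLp (jet u Du) 2 (volume.restrict Ω) :=
  Quasilinear.memLp_jet h.memLp h.memLp_grad

/-- Only the approximation property of `H^1_0` matters for membership in the closure. -/
theorem toLp_mem_sobolevJets {u : RN N → ℝ} {Du : RN N → RN N}
    (hm : MemLp (jet u Du) 2 (volume.restrict Ω))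
    (happ : ∀ ε : ENNReal, 0 < ε → ∃ φ : RN N → ℝ, IsTest Ω φ ∧
      eLpNorm (fun x => u x - φ x) 2 (volume.restrict Ω) ≤ ε ∧
      eLpNorm (fun x => Du x - gradient φ x) 2 (volume.restrict Ω) ≤ ε) :
    hm.toLp ∈ sobolevJets Ω := by
  refine EMetric.mem_closure_iff.2 fun ε hε => ?_
  obtain ⟨δ, hδ, hδε⟩ := ENNReal.lt_iff_exists_nnreal_btwn.1 hε
  obtain ⟨φ, hφ, h1, h2⟩ := happ (δ / 2) (ENNReal.half_pos hδ.ne')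
  refine ⟨_, hφ.toLp_mem, lt_of_le_of_lt ?_ hδε⟩
  rw [Lp.edist_toLp_toLp]
  have hu : MemLp u 2 (volume.restrict Ω) := hm.prodLp_fst
  have hDu : MemLp Du 2 (volume.restrict Ω) := hm.prodLp_snd
  calc _ ≤ _ := eLpNorm_jet_le (u := fun x => u x - φ x) (Du := fun x => Du x - gradient φ x)
        (hu.1.sub ((hφ.memLp 2).restrict Ω).1) (hDu.1.sub ((hφ.memLp_gradient 2).restrict Ω).1)
    _ ≤ δ / 2 + δ / 2 := add_le_add h1 h2
    _ = δ := ENNReal.add_halves _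

theorem IsH10.toLp_mem {u : RN N → ℝ} {Du : RN N → RN N} (h : IsH10 Ω u Du) :
    h.memLp_jet.toLp ∈ sobolevJets Ω :=
  toLp_mem_sobolevJets _ h.approx

theorem IsTest.isH10 {φ : RN N → ℝ} (h : IsTest Ω φ) : IsH10 Ω φ (gradient φ) :=
  isH10_of_mem_sobolevJets ((testJets Ω).le_topologicalClosure h.toLp_mem) (MemLp.coeFn_toLp _)

/-! ### Rellich's theorem -/

theorem eLpNorm_two_sq {α F : Type*} [MeasurableSpace α] [NormedAddCommGroup F] (f : α → F)
    (μ : Measure α) : eLpNorm f 2 μ ^ 2 = ∫⁻ x, ‖f x‖ₑ ^ 2 ∂μ := by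
  have := eLpNorm_nnreal_pow_eq_lintegral (p := 2) (μ := μ) (f := f) (by norm_num)
  simpa only [← ENNReal.rpow_natCast, ENNReal.coe_ofNat, NNReal.coe_ofNat, Nat.cast_ofNat] using this

/-- Jensen's inequality for the square of the norm. -/
theorem enorm_integral_sq_le {α : Type*} [MeasurableSpace α] (ν : Measure α)
    [IsProbabilityMeasure ν] {f : α → ℝ} (hf : AEStronglyMeasurable f ν) :
    ‖∫ y, f y ∂ν‖ₑ ^ 2 ≤ ∫⁻ y, ‖f y‖ₑ ^ 2 ∂ν := by
  rw [← eLpNorm_two_sq]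
  gcongr
  calc ‖∫ y, f y ∂ν‖ₑ ≤ ∫⁻ y, ‖f y‖ₑ ∂ν := enorm_integral_le_lintegral_enorm _
    _ = eLpNorm f 1 ν := eLpNorm_one_eq_lintegral_enorm.symm
    _ ≤ eLpNorm f 2 ν := eLpNorm_le_eLpNorm_of_exponent_le (by norm_num) hf

namespace IsTest

variable {φ : RN N → ℝ}

/-- `‖φ - φ(· + y)‖ ≤ |y| ‖∇φ‖` in `L²(ℝ^N)`, by integrating `∇φ` along segments. -/
theorem lintegral_translate_sub_le (h : IsTest Ω φ) (y : RN N) :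
    ∫⁻ x, ‖φ x - φ (x + y)‖ₑ ^ 2 ≤ ‖y‖ₑ ^ 2 * ∫⁻ x, ‖gradient φ x‖ₑ ^ 2 := by
  let ν : Measure ℝ := volume.restrict (Ioc 0 1)
  have : IsProbabilityMeasure ν := ⟨by simp [ν]⟩
  have hcf : Continuous (fderiv ℝ φ) := h.smooth.continuous_fderiv (by simp)
  have h1 : ∀ x, ‖φ x - φ (x + y)‖ₑ ^ 2
      ≤ ∫⁻ t, ‖y‖ₑ ^ 2 * ‖gradient φ (x + t • y)‖ₑ ^ 2 ∂ν := by
    intro x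
    have hd : ∀ t ∈ uIcc (0 : ℝ) 1,
        HasDerivAt (fun t : ℝ => φ (x + t • y)) (fderiv ℝ φ (x + t • y) y) t := by
      intro t _
      have e1 : HasDerivAt (fun t : ℝ => x + t • y) y t := by
        simpa using ((hasDerivAt_id t).smul_const y).const_add x
      exact (h.differentiable (x + t • y)).hasFDerivAt.comp_hasDerivAt t e1
    have hc : Continuous fun t : ℝ => fderiv ℝ φ (x + t • y) y := by fun_prop
    have e2 := intervalIntegral.integral_eq_sub_of_hasDerivAt hd (hc.intervalIntegrable _ _)
    rw [intervalIntegral.integral_of_le zero_le_one] at e2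
    simp only [one_smul, zero_smul, add_zero] at e2
    rw [← enorm_neg, neg_sub, ← e2]
    refine (enorm_integral_sq_le ν hc.aestronglyMeasurable).trans (lintegral_mono fun t => ?_)
    rw [← mul_pow]
    gcongr
    rw [← ofReal_norm, ← ofReal_norm, ← ofReal_norm, ← ENNReal.ofReal_mul (norm_nonneg _),
      norm_gradient, mul_comm]
    exact ENNReal.ofReal_le_ofReal (ContinuousLinearMap.le_opNorm _ _)
  have hcg := h.continuous_gradient
  calc ∫⁻ x, ‖φ x - φ (x + y)‖ₑ ^ 2
      ≤ ∫⁻ x, ∫⁻ t, ‖y‖ₑ ^ 2 * ‖gradient φ (x + t • y)‖ₑ ^ 2 ∂ν := lintegral_mono h1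
    _ = ∫⁻ t, (∫⁻ x, ‖y‖ₑ ^ 2 * ‖gradient φ (x + t • y)‖ₑ ^ 2) ∂ν := by
        refine lintegral_lintegral_swap (Continuous.aemeasurable ?_)
        have : Continuous fun p : RN N × ℝ => ‖gradient φ (p.1 + p.2 • y)‖ₑ ^ 2 := by fun_prop
        exact ENNReal.continuous_const_mul (by simp) |>.comp this
    _ = ∫⁻ _, (‖y‖ₑ ^ 2 * ∫⁻ x, ‖gradient φ x‖ₑ ^ 2) ∂ν := by
        refine lintegral_congr fun t => ?_
        rw [lintegral_const_mul' _ _ (by simp),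
          lintegral_add_right_eq_self (fun x => ‖gradient φ x‖ₑ ^ 2)]
    _ = _ := by simp

/-- Averaging over a probability measure concentrated in a small ball moves a test function by
little in `L²`, uniformly over a bounded set of gradients. -/
theorem lintegral_sub_average_le (h : IsTest Ω φ) (ν : Measure (RN N)) [IsProbabilityMeasure ν]
    {δ : ENNReal} (hν : ∀ᵐ y ∂ν, ‖y‖ₑ ≤ δ) :
    ∫⁻ x, ‖φ x - ∫ y, φ (x + y) ∂ν‖ₑ ^ 2 ≤ δ ^ 2 * ∫⁻ x, ‖gradient φ x‖ₑ ^ 2 := by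
  have hc := h.continuous
  have hint : ∀ x, Integrable (fun y => φ (x + y)) ν := fun x => by
    obtain ⟨C, hC⟩ := h.compact.exists_bound_of_continuous hc
    exact Integrable.of_bound (C := C) (by fun_prop) (Eventually.of_forall fun y => hC _)
  calc ∫⁻ x, ‖φ x - ∫ y, φ (x + y) ∂ν‖ₑ ^ 2
      ≤ ∫⁻ x, ∫⁻ y, ‖φ x - φ (x + y)‖ₑ ^ 2 ∂ν := by
        refine lintegral_mono fun x => ?_
        have : φ x - ∫ y, φ (x + y) ∂ν = ∫ y, (φ x - φ (x + y)) ∂ν := by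
          rw [integral_sub (integrable_const _) (hint x)]; simp
        rw [this]
        exact enorm_integral_sq_le ν (by fun_prop)
    _ = ∫⁻ y, (∫⁻ x, ‖φ x - φ (x + y)‖ₑ ^ 2) ∂ν := by
        refine lintegral_lintegral_swap (Continuous.aemeasurable ?_)
        fun_prop
    _ ≤ ∫⁻ _, (δ ^ 2 * ∫⁻ x, ‖gradient φ x‖ₑ ^ 2) ∂ν := by
        refine lintegral_mono_ae (hν.mono fun y hy => ?_)
        refine (h.lintegral_translate_sub_le y).trans ?_
        gcongr
    _ = _ := by simp

end IsTest

/-- The normalised Lebesgue measure of the ball of radius `δ` about the origin. -/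
def ballMeasure (N : ℕ) (δ : ℝ) : Measure (RN N) :=
  (volume (Metric.ball (0 : RN N) δ))⁻¹ • volume.restrict (Metric.ball (0 : RN N) δ)

theorem isProbabilityMeasure_ballMeasure {δ : ℝ} (hδ : 0 < δ) :
    IsProbabilityMeasure (ballMeasure N δ) := by
  refine ⟨?_⟩
  simp only [ballMeasure, Measure.smul_apply, Measure.restrict_apply_univ, smul_eq_mul]
  exact ENNReal.inv_mul_cancel (Metric.measure_ball_pos _ _ hδ).ne' measure_ball_lt_top.ne

theorem ballMeasure_enorm_le {δ : ℝ} : ∀ᵐ y ∂(ballMeasure N δ), ‖y‖ₑ ≤ ENNReal.ofReal δ := by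
  refine Measure.ae_smul_measure ?_ _
  filter_upwards [ae_restrict_mem measurableSet_ball] with y hy
  rw [← ofReal_norm]
  exact ENNReal.ofReal_le_ofReal (by simpa using (mem_ball_zero_iff.1 hy).le)

/-- The averages of a test function over balls of radius `δ` are inner products of its jet with
fixed elements of `L²`. -/
theorem IsTest.integral_ballMeasure {φ : RN N → ℝ} (h : IsTest Ω φ) {U : JetL2 Ω}
    (hU : U =ᵐ[volume.restrict Ω] jet φ (gradient φ)) (δ : ℝ) (x : RN N)
    (hμ : volume.restrict Ω (Metric.ball x δ) ≠ ⊤) :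
    ∫ y, φ (x + y) ∂(ballMeasure N δ) = (volume (Metric.ball (0 : RN N) δ))⁻¹.toReal *
      inner ℝ (indicatorConstLp 2 measurableSet_ball hμ (WithLp.toLp 2 ((1 : ℝ), (0 : RN N)))) U := by
  rw [ballMeasure, integral_smul_measure, smul_eq_mul]
  congr 1
  rw [L2.inner_indicatorConstLp_eq_setIntegral_inner, ← integral_indicator measurableSet_ball,
    ← integral_indicator measurableSet_ball]
  have e1 : ∫ y in Ω, (Metric.ball x δ).indicator
      (fun y => inner ℝ (WithLp.toLp 2 ((1 : ℝ), (0 : RN N)) : Jet N) (U y)) y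
      = ∫ y in Ω, (Metric.ball x δ).indicator φ y := by
    refine integral_congr_ae ?_
    filter_upwards [hU] with y hy
    have h1 : inner ℝ (WithLp.toLp 2 ((1 : ℝ), (0 : RN N)) : Jet N) (U y) = φ y := by
      rw [hy, Jet.inner_eq]; simp
    simp only [indicator, h1]
  rw [e1, setIntegral_eq_integral_of_forall_compl_eq_zero
    (fun y hy => by simp [indicator, h.eq_zero_of_notMem hy]),
    ← integral_add_left_eq_self ((Metric.ball x δ).indicator φ) x]
  congr 1 with y
  simp [indicator, dist_eq_norm]

/-- The core of Rellich's theorem: test functions that are bounded in `H^1` and tend weakly to `0`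
tend to `0` in `L²` of a bounded domain. Their averages over small balls tend to `0` pointwise and
boundedly, and the averages are uniformly close to the functions. -/
theorem tendsto_lintegral_sq_of_testJets [IsFiniteMeasure (volume.restrict Ω)]
    {φ : ℕ → RN N → ℝ} (hφ : ∀ n, IsTest Ω (φ n)) {U : ℕ → JetL2 Ω}
    (hU : ∀ n, U n =ᵐ[volume.restrict Ω] jet (φ n) (gradient (φ n))) {M : ℝ}
    (hM : ∀ n, ‖U n‖ ≤ M) (hw : WeakTendsto U 0) :
    Tendsto (fun n => ∫⁻ x in Ω, ‖φ n x‖ₑ ^ 2) atTop (𝓝 0) := by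
  have hM0 : 0 ≤ M := (norm_nonneg _).trans (hM 0)
  have hgrad : ∀ n, ∫⁻ x, ‖gradient (φ n) x‖ₑ ^ 2 ≤ ENNReal.ofReal M ^ 2 := by
    intro n
    have e1 : ∫⁻ x, ‖gradient (φ n) x‖ₑ ^ 2 = ∫⁻ x in Ω, ‖gradient (φ n) x‖ₑ ^ 2 := by
      refine (setLIntegral_eq_of_support_subset ?_).symm
      intro x hx
      by_contra hx'
      simp [(hφ n).gradient_eq_zero_of_notMem hx'] at hx
    rw [e1, ← eLpNorm_two_sq]
    gcongr
    calc eLpNorm (gradient (φ n)) 2 (volume.restrict Ω)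
        ≤ eLpNorm (U n) 2 (volume.restrict Ω) := by
          refine eLpNorm_mono_ae ?_
          filter_upwards [hU n] with x hx
          rw [hx]
          exact WithLp.norm_snd_le (x := jet (φ n) (gradient (φ n)) x)
      _ = ENNReal.ofReal ‖U n‖ := by rw [Lp.norm_def, ENNReal.ofReal_toReal (Lp.eLpNorm_ne_top _)]
      _ ≤ _ := ENNReal.ofReal_le_ofReal (hM n)
  refine ENNReal.tendsto_nhds_zero.2 fun ε hε => ?_
  obtain ⟨ε', hε', hεε⟩ := ENNReal.lt_iff_exists_nnreal_btwn.1 hε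
  have hε'0 : (0 : ℝ) < ε' := by exact_mod_cast hε'
  -- `δ` makes the averaging error, at most `δ M` in `L²`, harmless.
  obtain ⟨δ, hδ, hδε⟩ : ∃ δ : ℝ, 0 < δ ∧ 2 * (δ ^ 2 * M ^ 2) ≤ ε' / 2 := by
    have hc : Tendsto (fun δ : ℝ => 2 * (δ ^ 2 * M ^ 2)) (𝓝[>] 0) (𝓝 (2 * (0 ^ 2 * M ^ 2))) :=
      (Continuous.tendsto (by fun_prop) 0).mono_left nhdsWithin_le_nhds
    have h1 := hc.eventually_le_const (u := (ε' : ℝ) / 2) (by simpa using hε'0)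
    obtain ⟨δ, h2, h3⟩ := (h1.and self_mem_nhdsWithin).exists
    exact ⟨δ, h3, h2⟩
  have := isProbabilityMeasure_ballMeasure (N := N) hδ
  -- `A n` is the average of `φ n` over balls of radius `δ`.
  set A : ℕ → RN N → ℝ := fun n x => ∫ y, φ n (x + y) ∂(ballMeasure N δ) with hA
  have hμ : ∀ x, volume.restrict Ω (Metric.ball x δ) ≠ ⊤ := fun x => measure_ne_top _ _
  have hAeq : ∀ n x, A n x = _ := fun n x => (hφ n).integral_ballMeasure (hU n) δ x (hμ x)
  set c := (volume (Metric.ball (0 : RN N) δ))⁻¹.toReal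
  have hAmeas : ∀ n, StronglyMeasurable (A n) := fun n => by
    refine StronglyMeasurable.integral_prod_right' (f := fun p : RN N × RN N => φ n (p.1 + p.2)) ?_
    have := (hφ n).continuous
    exact Continuous.stronglyMeasurable (by fun_prop)
  have hAbound : ∀ n x, ‖A n x‖ ≤ c * ((volume.restrict Ω).real univ ^ (1 / (2 : ℝ)) * M) := by
    intro n x
    rw [hAeq, norm_mul, Real.norm_of_nonneg ENNReal.toReal_nonneg]
    gcongr
    refine (norm_inner_le_norm _ _).trans ?_
    gcongr
    · rw [norm_indicatorConstLp (by norm_num) (by norm_num)]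
      have : ‖(WithLp.toLp 2 ((1 : ℝ), (0 : RN N)) : Jet N)‖ = 1 := by
        rw [WithLp.norm_toLp_fst]; simp
      rw [this, one_mul]
      simp only [ENNReal.toReal_ofNat]
      gcongr
      · exact measure_ne_top _ _
      · exact subset_univ _
    · exact hM n
  have hAlim : Tendsto (fun n => ∫⁻ x in Ω, ‖A n x‖ₑ ^ 2) atTop (𝓝 0) := by
    have := tendsto_lintegral_of_dominated_convergence (μ := volume.restrict Ω)
      (F := fun n x => ‖A n x‖ₑ ^ 2) (f := fun _ => 0)
      (fun _ => ENNReal.ofReal (c * ((volume.restrict Ω).real univ ^ (1 / (2 : ℝ)) * M)) ^ 2)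
      (fun n => (hAmeas n).measurable.enorm.pow_const 2)
      (fun n => Eventually.of_forall fun x => by
        dsimp only
        gcongr
        rw [← ofReal_norm]
        exact ENNReal.ofReal_le_ofReal (hAbound n x))
      (by rw [lintegral_const]; exact ENNReal.mul_ne_top (by simp) (measure_ne_top _ _))
      (Eventually.of_forall fun x => by
        have h1 : Tendsto (fun n => A n x) atTop (𝓝 0) := by
          simp_rw [hAeq]
          simpa using (hw (indicatorConstLp 2 measurableSet_ball (hμ x)
            (WithLp.toLp 2 ((1 : ℝ), (0 : RN N))))).const_mul c
        have h2 : Continuous fun t : ℝ => ‖t‖ₑ ^ 2 := by fun_prop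
        simpa [Function.comp_def] using (h2.tendsto 0).comp h1)
    simpa using this
  have hA2 : Tendsto (fun n => 2 * ∫⁻ x in Ω, ‖A n x‖ₑ ^ 2) atTop (𝓝 0) := by
    simpa using ENNReal.Tendsto.const_mul hAlim (Or.inr (by simp : (2 : ENNReal) ≠ ⊤))
  filter_upwards [hA2.eventually_le_const (u := (ε' / 2 : ENNReal)) (ENNReal.half_pos hε'.ne')]
    with n hn
  have hsplit : ∀ x, ‖φ n x‖ₑ ^ 2 ≤ 2 * ‖φ n x - A n x‖ₑ ^ 2 + 2 * ‖A n x‖ₑ ^ 2 := by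
    intro x
    simp only [← ofReal_norm, ← ENNReal.ofReal_pow (norm_nonneg _)]
    rw [← ENNReal.ofReal_ofNat 2, ← ENNReal.ofReal_mul (by norm_num),
      ← ENNReal.ofReal_mul (by norm_num), ← ENNReal.ofReal_add (by positivity) (by positivity)]
    refine ENNReal.ofReal_le_ofReal ?_
    simp only [Real.norm_eq_abs, sq_abs]
    nlinarith [sq_nonneg (φ n x - 2 * A n x)]
  calc ∫⁻ x in Ω, ‖φ n x‖ₑ ^ 2
      ≤ ∫⁻ x in Ω, (2 * ‖φ n x - A n x‖ₑ ^ 2 + 2 * ‖A n x‖ₑ ^ 2) := lintegral_mono hsplit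
    _ = 2 * (∫⁻ x in Ω, ‖φ n x - A n x‖ₑ ^ 2) + 2 * ∫⁻ x in Ω, ‖A n x‖ₑ ^ 2 := by
        rw [lintegral_add_right _ (((hAmeas n).measurable.enorm.pow_const 2).const_mul 2),
          lintegral_const_mul' _ _ (by simp), lintegral_const_mul' _ _ (by simp)]
    _ ≤ 2 * (ENNReal.ofReal δ ^ 2 * ENNReal.ofReal M ^ 2) + ε' / 2 := by
        gcongr
        exact (setLIntegral_le_lintegral _ _).trans
          (((hφ n).lintegral_sub_average_le _ ballMeasure_enorm_le).trans (by gcongr; exact hgrad n))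
    _ ≤ ε' / 2 + ε' / 2 := by
        gcongr
        rw [← ENNReal.ofReal_pow hδ.le, ← ENNReal.ofReal_pow hM0,
          ← ENNReal.ofReal_mul (by positivity), ← ENNReal.ofReal_ofNat 2,
          ← ENNReal.ofReal_mul (by norm_num), ← ENNReal.ofReal_coe_nnreal,
          ← ENNReal.ofReal_div_of_pos (by norm_num)]
        exact ENNReal.ofReal_le_ofReal hδε
    _ = ε' := ENNReal.add_halves _
    _ ≤ ε := hεε.le

/-- The function component of a pair `(u, ∇u)`, as a bounded operator on `L²`. -/
def fstL2 (Ω : Set (RN N)) : JetL2 Ω →L[ℝ] Lp ℝ 2 (volume.restrict Ω) :=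
  (WithLp.fstL 2 ℝ ℝ (RN N)).compLpL 2 (volume.restrict Ω)

theorem coeFn_fstL2 (U : JetL2 Ω) : fstL2 Ω U =ᵐ[volume.restrict Ω] fun x => (U x).fst :=
  ContinuousLinearMap.coeFn_compLpL _ _

/-- Rellich's theorem for `H^1_0` of a set of finite measure, in sequential form. -/
theorem tendsto_fstL2 [IsFiniteMeasure (volume.restrict Ω)] {U : ℕ → JetL2 Ω} {V : JetL2 Ω}
    {M : ℝ} (hU : ∀ n, U n ∈ sobolevJets Ω) (hV : V ∈ sobolevJets Ω) (hM : ∀ n, ‖U n‖ ≤ M)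
    (hw : WeakTendsto U V) : Tendsto (fun n => fstL2 Ω (U n)) atTop (𝓝 (fstL2 Ω V)) := by
  -- `U n - V` tends weakly to `0` in `H^1_0` and is replaced by test functions at distance `o(1)`.
  have happ : ∀ n : ℕ, ∃ X ∈ testJets Ω, dist (U n - V) X < 1 / ((n : ℝ) + 1) := fun n =>
    Metric.mem_closure_iff.1 ((sobolevJets Ω).sub_mem (hU n) hV) _ (by positivity)
  choose X hX hXd using happ
  have hdist : Tendsto (fun n => U n - V - X n) atTop (𝓝 0) := by
    refine squeeze_zero_norm (fun n => ?_) (tendsto_one_div_add_atTop_nhds_zero_nat (𝕜 := ℝ))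
    rw [← dist_eq_norm]
    exact (hXd n).le
  have hXw : WeakTendsto X 0 := by
    intro w
    have h1 : Tendsto (fun n => inner ℝ w (U n) - inner ℝ w V - inner ℝ w (U n - V - X n)) atTop
        (𝓝 (inner ℝ w V - inner ℝ w V - inner ℝ w 0)) :=
      ((hw w).sub_const _).sub (tendsto_const_nhds.inner hdist)
    refine Tendsto.congr (fun n => ?_) (by simpa using h1)
    simp only [inner_sub_right]
    ring
  have hXb : ∀ n, ‖X n‖ ≤ M + ‖V‖ + 1 := by
    intro n
    have h1 := hXd n
    have h2 : 1 / ((n : ℝ) + 1) ≤ 1 := by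
      rw [div_le_one (by positivity)]; linarith [Nat.cast_nonneg (α := ℝ) n]
    rw [dist_eq_norm] at h1
    have h3 : ‖X n‖ ≤ ‖U n - V‖ + ‖U n - V - X n‖ := by
      simpa using norm_sub_le (U n - V) (U n - V - X n)
    linarith [norm_sub_le (U n) V, hM n]
  choose φ hφ hφX using hX
  have h0 := tendsto_lintegral_sq_of_testJets hφ hφX hXb hXw
  have hX0 : Tendsto (fun n => fstL2 Ω (X n)) atTop (𝓝 0) := by
    rw [Lp.tendsto_Lp_iff_tendsto_eLpNorm']
    have h1 : ∀ n, eLpNorm (⇑(fstL2 Ω (X n)) - ⇑(0 : Lp ℝ 2 (volume.restrict Ω))) 2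
        (volume.restrict Ω) = (∫⁻ x in Ω, ‖φ n x‖ₑ ^ 2) ^ (1 / 2 : ℝ) := by
      intro n
      have h2 : (⇑(fstL2 Ω (X n)) - ⇑(0 : Lp ℝ 2 (volume.restrict Ω))) =ᵐ[volume.restrict Ω]
          φ n := by
        filter_upwards [coeFn_fstL2 (X n), hφX n, Lp.coeFn_zero ℝ 2 (volume.restrict Ω)]
          with x h3 h4 h5
        rw [Pi.sub_apply, h3, h4, h5]
        simp
      rw [eLpNorm_congr_ae h2, ← eLpNorm_two_sq, ← ENNReal.rpow_natCast, ← ENNReal.rpow_mul]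
      norm_num
    simp_rw [h1]
    simpa [Function.comp_def] using (ENNReal.continuous_rpow_const (y := 1 / 2)).tendsto 0 |>.comp h0
  have h2 : Tendsto (fun n => fstL2 Ω (U n - V - X n) + fstL2 Ω (X n) + fstL2 Ω V) atTop
      (𝓝 (fstL2 Ω 0 + 0 + fstL2 Ω V)) :=
    ((((fstL2 Ω).continuous.tendsto 0).comp hdist).add hX0).add_const _
  simpa using h2

/-! ### Integral functionals with derivative of linear growth -/

theorem integrable_mul_of_memLp_two {α : Type*} [MeasurableSpace α] {μ : Measure α} {f g : α → ℝ}
    (hf : MemLp f 2 μ) (hg : MemLp g 2 μ) : Integrable (fun x => f x * g x) μ :=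
  MeasureTheory.MemLp.integrable_mul (p := 2) (q := 2) hf hg

theorem memLp_one_add {α : Type*} [MeasurableSpace α] {μ : Measure α} [IsFiniteMeasure μ]
    {f : α → ℝ} (hf : MemLp f 2 μ) : MemLp (fun x => 1 + f x) 2 μ :=
  MemLp.add (f := fun _ => (1 : ℝ)) (g := f) (memLp_const (1 : ℝ)) hf

section Functional

variable {E : Type*} [NormedAddCommGroup E] [NormedSpace ℝ E]

/-- `Ψ` is continuously differentiable with derivative `Ψ'` of at most linear growth. -/
structure LinearGrowthDeriv (Ψ : E → ℝ) (Ψ' : E → E →L[ℝ] ℝ) (C : ℝ) : Prop where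
  nonneg : 0 ≤ C
  hasFDerivAt : ∀ z, HasFDerivAt Ψ (Ψ' z) z
  continuous_deriv : Continuous Ψ'
  bound : ∀ z, ‖Ψ' z‖ ≤ C * (1 + ‖z‖)

namespace LinearGrowthDeriv

variable {Ψ : E → ℝ} {Ψ' : E → E →L[ℝ] ℝ} {C : ℝ}

theorem continuous (h : LinearGrowthDeriv Ψ Ψ' C) : Continuous Ψ :=
  continuous_iff_continuousAt.2 fun z => (h.hasFDerivAt z).continuousAt

/-- The mean value inequality on the ball of radius `‖a‖ + ‖b‖`. -/
theorem abs_sub_le (h : LinearGrowthDeriv Ψ Ψ' C) (a b : E) :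
    |Ψ a - Ψ b| ≤ C * (1 + (‖a‖ + ‖b‖)) * ‖a - b‖ := by
  have := (convex_closedBall (0 : E) (‖a‖ + ‖b‖)).norm_image_sub_le_of_norm_hasFDerivWithin_le
    (f := Ψ) (f' := Ψ') (C := C * (1 + (‖a‖ + ‖b‖))) (x := b) (y := a)
    (fun z _ => (h.hasFDerivAt z).hasFDerivWithinAt) (fun z hz => ?_) (by simp) (by simp)
  · simpa using this
  · refine (h.bound z).trans ?_
    have := h.nonneg
    gcongr
    simpa using hz

variable {α : Type*} [MeasurableSpace α] {μ : Measure α} [IsFiniteMeasure μ]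

theorem integrable_comp (h : LinearGrowthDeriv Ψ Ψ' C) {u : α → E} (hu : MemLp u 2 μ) :
    Integrable (fun x => Ψ (u x)) μ := by
  have h1 : MemLp (fun x => 1 + ‖u x‖) 2 μ := memLp_one_add hu.norm
  have h2 : Integrable (fun x => (1 + ‖u x‖) * ‖u x‖) μ := integrable_mul_of_memLp_two h1 hu.norm
  refine ((integrable_const |Ψ 0|).add (h2.const_mul C)).mono'
    (h.continuous.comp_aestronglyMeasurable hu.1) (Eventually.of_forall fun x => ?_)
  have h3 := h.abs_sub_le (u x) 0
  simp only [norm_zero, add_zero, sub_zero] at h3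
  have h4 := abs_sub_abs_le_abs_sub (Ψ (u x)) (Ψ 0)
  simp only [Real.norm_eq_abs, Pi.add_apply]
  linarith [mul_assoc C (1 + ‖u x‖) ‖u x‖]

/-- The functional `U ↦ ∫ Ψ(U)` is continuous on `L²`. -/
theorem continuous_integral (h : LinearGrowthDeriv Ψ Ψ' C) :
    Continuous fun U : Lp E 2 μ => ∫ x, Ψ (U x) ∂μ := by
  rw [continuous_iff_continuousAt]
  intro V
  have hW : MemLp (fun x => 1 + 2 * ‖V x‖) 2 μ := memLp_one_add ((Lp.memLp V).norm.const_mul 2)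
  have key : ∀ U : Lp E 2 μ, ‖(∫ x, Ψ (U x) ∂μ) - ∫ x, Ψ (V x) ∂μ‖
      ≤ C * ((‖hW.toLp‖ + ‖U - V‖) * ‖U - V‖) := by
    intro U
    have hD : MemLp (fun x => ‖(U - V : Lp E 2 μ) x‖) 2 μ := (Lp.memLp (U - V)).norm
    have hDn : ‖hD.toLp‖ = ‖U - V‖ := by
      rw [Lp.norm_toLp, Lp.norm_def, eLpNorm_norm]
    have e1 : ∫ x, (1 + 2 * ‖V x‖ + ‖(U - V : Lp E 2 μ) x‖) * ‖(U - V : Lp E 2 μ) x‖ ∂μ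
        = inner ℝ (hW.toLp + hD.toLp) hD.toLp := by
      rw [L2.inner_def]
      refine integral_congr_ae ?_
      filter_upwards [hW.coeFn_toLp, hD.coeFn_toLp, Lp.coeFn_add hW.toLp hD.toLp] with x h1 h2 h3
      rw [h3, Pi.add_apply, h1, h2]
      simp [mul_comm]
    have i1 : Integrable
        (fun x => (1 + 2 * ‖V x‖ + ‖(U - V : Lp E 2 μ) x‖) * ‖(U - V : Lp E 2 μ) x‖) μ :=
      integrable_mul_of_memLp_two (hW.add hD) hD
    rw [← integral_sub (h.integrable_comp (Lp.memLp U)) (h.integrable_comp (Lp.memLp V))]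
    calc _ ≤ ∫ x, C * ((1 + 2 * ‖V x‖ + ‖(U - V : Lp E 2 μ) x‖) * ‖(U - V : Lp E 2 μ) x‖) ∂μ := by
          refine norm_integral_le_of_norm_le (i1.const_mul C) ?_
          filter_upwards [Lp.coeFn_sub U V] with x hx
          rw [hx, Pi.sub_apply, Real.norm_eq_abs]
          refine (h.abs_sub_le _ _).trans ?_
          rw [mul_assoc]
          have h2 := norm_add_le (U x - V x) (V x)
          rw [sub_add_cancel] at h2
          exact mul_le_mul_of_nonneg_left
            (mul_le_mul_of_nonneg_right (by linarith) (norm_nonneg _)) h.nonneg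
      _ = C * inner ℝ (hW.toLp + hD.toLp) hD.toLp := by rw [integral_const_mul, e1]
      _ ≤ C * ((‖hW.toLp‖ + ‖U - V‖) * ‖U - V‖) := by
          have := h.nonneg
          gcongr
          refine (real_inner_le_norm _ _).trans ?_
          rw [hDn]
          gcongr
          exact (norm_add_le _ _).trans_eq (by rw [hDn])
  rw [ContinuousAt, tendsto_iff_norm_sub_tendsto_zero]
  refine squeeze_zero (fun _ => norm_nonneg _) key ?_
  have hc : Continuous fun U : Lp E 2 μ => C * ((‖hW.toLp‖ + ‖U - V‖) * ‖U - V‖) := by fun_prop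
  simpa using hc.tendsto V

/-- The Gateaux derivative of `u ↦ ∫ Ψ(u)` at `u` in the direction `v` is `∫ Ψ'(u) v`. -/
theorem hasDerivAt_integral (h : LinearGrowthDeriv Ψ Ψ' C) {u v : α → E}
    (hu : MemLp u 2 μ) (hv : MemLp v 2 μ) :
    Integrable (fun x => Ψ' (u x) (v x)) μ ∧
    HasDerivAt (fun t : ℝ => ∫ x, Ψ (u x + t • v x) ∂μ) (∫ x, Ψ' (u x) (v x) ∂μ) 0 := by
  have hmeas : AEStronglyMeasurable (fun x => Ψ' (u x) (v x)) μ :=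
    isBoundedBilinearMap_apply.continuous.comp_aestronglyMeasurable
      ((h.continuous_deriv.comp_aestronglyMeasurable hu.1).prodMk hv.1)
  have h1 : MemLp (fun x => 1 + (‖u x‖ + ‖v x‖)) 2 μ := memLp_one_add (hu.norm.add hv.norm)
  have h2 : Integrable (fun x => (1 + (‖u x‖ + ‖v x‖)) * ‖v x‖) μ :=
    integrable_mul_of_memLp_two h1 hv.norm
  have := hasDerivAt_integral_of_dominated_loc_of_deriv_le (μ := μ) (𝕜 := ℝ)
    (F := fun t x => Ψ (u x + t • v x)) (F' := fun t x => Ψ' (u x + t • v x) (v x)) (x₀ := 0)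
    (s := Metric.ball 0 1) (bound := fun x => C * ((1 + (‖u x‖ + ‖v x‖)) * ‖v x‖))
    (Metric.ball_mem_nhds _ one_pos)
    (Eventually.of_forall fun t => (h.integrable_comp (hu.add (hv.const_smul t))).1)
    (by simpa using h.integrable_comp hu) (by simpa using hmeas)
    (Eventually.of_forall fun x t ht => ?_) (h2.const_mul C)
    (Eventually.of_forall fun x t _ => ?_)
  · simpa using this
  · refine (ContinuousLinearMap.le_opNorm _ _).trans ?_
    rw [← mul_assoc]
    gcongr
    refine (h.bound _).trans ?_
    have := h.nonneg
    gcongr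
    refine (norm_add_le _ _).trans ?_
    gcongr
    rw [norm_smul]
    exact mul_le_of_le_one_left (norm_nonneg _) (mem_ball_zero_iff.1 ht).le
  · have e1 : HasDerivAt (fun t : ℝ => u x + t • v x) (v x) t := by
      simpa using ((hasDerivAt_id t).smul_const (v x)).const_add (u x)
    exact (h.hasFDerivAt _).comp_hasDerivAt t e1

theorem convexOn_integral (h : LinearGrowthDeriv Ψ Ψ' C) (hΨ : ConvexOn ℝ univ Ψ) :
    ConvexOn ℝ univ fun U : Lp E 2 μ => ∫ x, Ψ (U x) ∂μ := by
  refine ⟨convex_univ, fun U _ V _ a b ha hb hab => ?_⟩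
  have hU := h.integrable_comp (Lp.memLp U)
  have hV := h.integrable_comp (Lp.memLp V)
  have e : a • (∫ x, Ψ (U x) ∂μ) + b • (∫ x, Ψ (V x) ∂μ)
      = ∫ x, (a • Ψ (U x) + b • Ψ (V x)) ∂μ := by
    simp only [smul_eq_mul]
    rw [integral_add (hU.const_mul a) (hV.const_mul b), integral_const_mul, integral_const_mul]
  dsimp only
  rw [e]
  refine integral_mono_ae (h.integrable_comp (Lp.memLp _)) ((hU.smul a).add (hV.smul b)) ?_
  filter_upwards [Lp.coeFn_add (a • U) (b • V), Lp.coeFn_smul a U, Lp.coeFn_smul b V]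
    with x h1 h2 h3
  rw [h1, Pi.add_apply, h2, h3]
  exact hΨ.2 (mem_univ _) (mem_univ _) ha hb hab

end LinearGrowthDeriv

end Functional

theorem hasDerivAt_primitive {k : ℝ → ℝ} (hk : Continuous k) (t : ℝ) :
    HasDerivAt (primitive k) (k t) t :=
  intervalIntegral.integral_hasDerivAt_right (hk.intervalIntegrable _ _)
    (hk.stronglyMeasurableAtFilter _ _) hk.continuousAt

theorem primitive_zero (k : ℝ → ℝ) : primitive k 0 = 0 := intervalIntegral.integral_same

theorem continuous_primitive {k : ℝ → ℝ} (hk : Continuous k) : Continuous (primitive k) :=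
  continuous_iff_continuousAt.2 fun t => (hasDerivAt_primitive hk t).continuousAt

theorem mul_le_primitive {k : ℝ → ℝ} (hk : Continuous k) {c : ℝ} (hc : ∀ t, c ≤ k t) {t : ℝ}
    (ht : 0 ≤ t) : c * t ≤ primitive k t := by
  have := intervalIntegral.integral_mono_on (μ := volume) ht
    (by simp : IntervalIntegrable (fun _ => c) volume 0 t)
    (hk.intervalIntegrable _ _) (fun x _ => hc x)
  simpa [mul_comm, primitive] using this

theorem monotone_primitive {k : ℝ → ℝ} (hk : Continuous k) (h0 : ∀ t, 0 ≤ k t) :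
    Monotone (primitive k) :=
  monotone_of_hasDerivAt_nonneg (hasDerivAt_primitive hk) h0

/-- The growth condition for the primitive of a continuous function of linear growth. -/
theorem linearGrowthDeriv_primitive {k : ℝ → ℝ} (hk : Continuous k) {C : ℝ} (hC : 0 ≤ C)
    (hkC : ∀ t, |k t| ≤ C * (1 + |t|)) :
    LinearGrowthDeriv (primitive k) (fun t => ContinuousLinearMap.toSpanSingleton ℝ (k t)) C where
  nonneg := hC
  hasFDerivAt t := (hasDerivAt_primitive hk t).hasFDerivAt
  continuous_deriv := by
    have : Continuous fun c : ℝ => ContinuousLinearMap.toSpanSingleton ℝ c :=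
      (ContinuousLinearMap.toSpanSingletonCLE (𝕜 := ℝ) (E := ℝ)).continuous
    exact this.comp hk
  bound t := by simpa using hkC t

section Principal

variable {H : Type*} [NormedAddCommGroup H] [InnerProductSpace ℝ H]

/-- The growth condition for `z ↦ Γ(‖z‖²/2)`, whose derivative at `z` is `γ(‖z‖²/2) ⟨z, ·⟩`. -/
theorem linearGrowthDeriv_norm_sq {γ : ℝ → ℝ} (hγ : Continuous γ) {C : ℝ} (hC : ∀ t, |γ t| ≤ C) :
    LinearGrowthDeriv (fun z : H => primitive γ (‖z‖ ^ 2 / 2))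
      (fun z => γ (‖z‖ ^ 2 / 2) • innerSL ℝ z) C where
  nonneg := (abs_nonneg _).trans (hC 0)
  hasFDerivAt z := by
    have h1 : HasFDerivAt (fun z : H => ‖z‖ ^ 2 / 2) (innerSL ℝ z) z := by
      have h2 := ((hasStrictFDerivAt_norm_sq z).hasFDerivAt).const_mul (1 / 2 : ℝ)
      refine (h2.congr_fderiv ?_).congr_of_eventuallyEq (Eventually.of_forall fun y => ?_)
      · ext y; simp
      · simp only; ring
    exact (hasDerivAt_primitive hγ _).comp_hasFDerivAt z h1
  continuous_deriv := by
    have : Continuous fun z : H => γ (‖z‖ ^ 2 / 2) := hγ.comp (by fun_prop)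
    exact this.smul (innerSL ℝ).continuous
  bound z := by
    rw [norm_smul, innerSL_apply_norm, Real.norm_eq_abs]
    have := (abs_nonneg _).trans (hC 0)
    gcongr
    · exact hC _
    · linarith

/-- Convexity of `z ↦ Γ(‖z‖²/2)`: the norm is convex and `t ↦ Γ(t²)` is convex and
non-decreasing on `[0, ∞)`. -/
theorem convexOn_primitive_norm_sq {γ : ℝ → ℝ} (hγ : Continuous γ) (h0 : ∀ t, 0 ≤ γ t)
    (hΓ : ConvexOn ℝ (Ici 0) fun t : ℝ => primitive γ (t ^ 2)) :
    ConvexOn ℝ univ fun z : H => primitive γ (‖z‖ ^ 2 / 2) := by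
  have hs : ∀ z : H, ‖z‖ ^ 2 / 2 = (‖z‖ / √2) ^ 2 := fun z => by
    rw [div_pow, Real.sq_sqrt (by norm_num)]
  refine ⟨convex_univ, fun z _ w _ a b ha hb hab => ?_⟩
  have h1 := hΓ.2 (x := ‖z‖ / √2) (y := ‖w‖ / √2) (mem_Ici.2 (by positivity))
    (mem_Ici.2 (by positivity)) ha hb hab
  simp only [hs]
  refine le_trans (monotone_primitive hγ h0 ?_) h1
  have h2 : ‖a • z + b • w‖ ≤ a * ‖z‖ + b * ‖w‖ := by
    refine (norm_add_le _ _).trans_eq ?_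
    rw [norm_smul, norm_smul, Real.norm_of_nonneg ha, Real.norm_of_nonneg hb]
  have h3 : a • (‖z‖ / √2) + b • (‖w‖ / √2) = (a * ‖z‖ + b * ‖w‖) / √2 := by
    simp only [smul_eq_mul]; ring
  rw [h3]
  gcongr

end Principal

/-! ### The chain rule in `H^1_0` -/

theorem tendsto_eLpNorm_two_zero {α ι F : Type*} [MeasurableSpace α] [NormedAddCommGroup F]
    {μ : Measure α} {l : Filter ι} {f : ι → α → F}
    (h : Tendsto (fun n => ∫⁻ x, ‖f n x‖ₑ ^ 2 ∂μ) l (𝓝 0)) :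
    Tendsto (fun n => eLpNorm (f n) 2 μ) l (𝓝 0) := by
  have h1 : ∀ n, eLpNorm (f n) 2 μ = (∫⁻ x, ‖f n x‖ₑ ^ 2 ∂μ) ^ (1 / 2 : ℝ) := by
    intro n
    rw [← eLpNorm_two_sq, ← ENNReal.rpow_natCast, ← ENNReal.rpow_mul]
    norm_num
  simp_rw [h1]
  simpa [Function.comp_def] using
    ((ENNReal.continuous_rpow_const (y := 1 / 2)).tendsto 0).comp h

/-- The chain rule in `H^1_0`: composition with a smooth function that vanishes at `0` and has
bounded derivative. -/
theorem IsH10.comp {u : RN N → ℝ} {Du : RN N → RN N} (h : IsH10 Ω u Du) {β : ℝ → ℝ}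
    (hβ : ContDiff ℝ ∞ β) (hβ0 : β 0 = 0) {L : ℝ} (hL : ∀ t, |deriv β t| ≤ L) :
    IsH10 Ω (fun x => β (u x)) (fun x => deriv β (u x) • Du x) := by
  have hL0 : 0 ≤ L := (abs_nonneg _).trans (hL 0)
  have hβc : Continuous β := hβ.continuous
  have hβ'c : Continuous (deriv β) := hβ.continuous_deriv (by simp)
  have hlip : ∀ a b, ‖β a - β b‖ ≤ L * ‖a - b‖ := fun a b =>
    Convex.norm_image_sub_le_of_norm_deriv_le (s := univ)
      (fun x _ => (hβ.differentiable (by simp)) x) (fun x _ => hL x) convex_univ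
      (mem_univ _) (mem_univ _)
  have hm : MemLp (fun x => β (u x)) 2 (volume.restrict Ω) :=
    h.memLp.of_le_mul (c := L) (hβc.comp_aestronglyMeasurable h.memLp.1)
      (Eventually.of_forall fun x => by simpa [hβ0] using hlip (u x) 0)
  have hm' : MemLp (fun x => deriv β (u x) • Du x) 2 (volume.restrict Ω) :=
    h.memLp_grad.of_le_mul (c := L)
      ((hβ'c.comp_aestronglyMeasurable h.memLp.1).smul h.memLp_grad.1)
      (Eventually.of_forall fun x => by
        rw [norm_smul]; exact mul_le_mul_of_nonneg_right (hL _) (norm_nonneg _))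
  refine isH10_of_mem_sobolevJets (toLp_mem_sobolevJets (Quasilinear.memLp_jet hm hm')
    fun ε hε => ?_) (MemLp.coeFn_toLp _)
  have hpos : ∀ n : ℕ, (0 : ENNReal) < ((n : ENNReal) + 1)⁻¹ := fun n => by simp
  choose φ hφ hφu hφD using fun n : ℕ => h.approx _ (hpos n)
  have hinv : Tendsto (fun n : ℕ => ((n : ENNReal) + 1)⁻¹) atTop (𝓝 0) := by
    have := (tendsto_add_atTop_iff_nat 1).2 ENNReal.tendsto_inv_nat_nhds_zero
    simpa using this
  have t1 : Tendsto (fun n => eLpNorm (fun x => u x - φ n x) 2 (volume.restrict Ω)) atTop (𝓝 0) :=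
    tendsto_of_tendsto_of_tendsto_of_le_of_le tendsto_const_nhds hinv (fun _ => zero_le) hφu
  have t2 : Tendsto (fun n => eLpNorm (fun x => Du x - gradient (φ n) x) 2 (volume.restrict Ω))
      atTop (𝓝 0) :=
    tendsto_of_tendsto_of_tendsto_of_le_of_le tendsto_const_nhds hinv (fun _ => zero_le) hφD
  -- Only the factor `β'(u) - β'(φ n)` needs pointwise convergence, hence a subsequence.
  obtain ⟨ns, hns, hae⟩ := (tendstoInMeasure_of_tendsto_eLpNorm (p := 2) (f := φ) (g := u)
    (by norm_num) (fun n => ((hφ n).memLp 2).1.restrict) h.memLp.1 (by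
      refine t1.congr fun n => ?_
      rw [← eLpNorm_neg]
      congr 1
      ext x; simp)).exists_seq_tendsto_ae
  have t3 : Tendsto (fun n => eLpNorm (fun x => (deriv β (u x) - deriv β (φ (ns n) x)) • Du x) 2
      (volume.restrict Ω)) atTop (𝓝 0) := by
    refine tendsto_eLpNorm_two_zero ?_
    have := tendsto_lintegral_of_dominated_convergence' (μ := volume.restrict Ω)
      (F := fun n x => ‖(deriv β (u x) - deriv β (φ (ns n) x)) • Du x‖ₑ ^ 2) (f := fun _ => 0)
      (fun x => ENNReal.ofReal (2 * L) ^ 2 * ‖Du x‖ₑ ^ 2)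
      (fun n => (((hβ'c.comp_aestronglyMeasurable h.memLp.1).sub
        ((hβ'c.comp (hφ (ns n)).continuous).aestronglyMeasurable)).smul
          h.memLp_grad.1).enorm.pow_const 2)
      (fun n => Eventually.of_forall fun x => by
        dsimp only
        rw [enorm_smul, mul_pow]
        gcongr
        rw [← ofReal_norm]
        refine ENNReal.ofReal_le_ofReal ((norm_sub_le _ _).trans ?_)
        have h1 := hL (u x)
        have h2 := hL (φ (ns n) x)
        simp only [Real.norm_eq_abs]
        linarith)
      (by
        rw [lintegral_const_mul' _ _ (ENNReal.pow_ne_top ENNReal.ofReal_ne_top), ← eLpNorm_two_sq]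
        exact ENNReal.mul_ne_top (ENNReal.pow_ne_top ENNReal.ofReal_ne_top)
          (ENNReal.pow_ne_top h.memLp_grad.2.ne))
      (by
        filter_upwards [hae] with x hx
        have h1 : Continuous fun t : ℝ => ‖(deriv β (u x) - deriv β t) • Du x‖ₑ ^ 2 := by fun_prop
        simpa [Function.comp_def] using (h1.tendsto (u x)).comp hx)
    simpa using this
  have t4 : Tendsto (fun n => eLpNorm (fun x => (deriv β (u x) - deriv β (φ (ns n) x)) • Du x) 2
      (volume.restrict Ω) + ENNReal.ofReal L *
        eLpNorm (fun x => Du x - gradient (φ (ns n)) x) 2 (volume.restrict Ω)) atTop (𝓝 0) := by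
    simpa using t3.add (ENNReal.Tendsto.const_mul (t2.comp hns.tendsto_atTop)
      (Or.inr ENNReal.ofReal_ne_top))
  have t5 : Tendsto (fun n => ENNReal.ofReal L *
      eLpNorm (fun x => u x - φ (ns n) x) 2 (volume.restrict Ω)) atTop (𝓝 0) := by
    simpa using ENNReal.Tendsto.const_mul (t1.comp hns.tendsto_atTop)
      (Or.inr (ENNReal.ofReal_ne_top (r := L)))
  obtain ⟨n, h4, h5⟩ := ((t4.eventually_le_const hε).and (t5.eventually_le_const hε)).exists
  refine ⟨_, (hφ (ns n)).comp hβ hβ0, ?_, ?_⟩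
  · exact (eLpNorm_le_mul_eLpNorm_of_ae_le_mul
      (Eventually.of_forall fun x => hlip (u x) (φ (ns n) x)) 2).trans h5
  · refine le_trans ?_ h4
    have e1 : (fun x => deriv β (u x) • Du x - gradient (fun x => β (φ (ns n) x)) x)
        = (fun x => (deriv β (u x) - deriv β (φ (ns n) x)) • Du x)
          + fun x => deriv β (φ (ns n) x) • (Du x - gradient (φ (ns n)) x) := by
      ext1 x
      rw [(hφ (ns n)).gradient_comp hβ, Pi.add_apply, sub_smul, smul_sub]
      abel
    have m1 : AEStronglyMeasurable (fun x => deriv β (φ (ns n) x)) (volume.restrict Ω) :=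
      (hβ'c.comp (hφ (ns n)).continuous).aestronglyMeasurable
    rw [e1]
    refine (eLpNorm_add_le (((hβ'c.comp_aestronglyMeasurable h.memLp.1).sub m1).smul
      h.memLp_grad.1) (m1.smul (h.memLp_grad.1.sub
        ((hφ (ns n)).memLp_gradient 2).1.restrict)) (by norm_num)).trans ?_
    refine add_le_add le_rfl ?_
    refine eLpNorm_le_mul_eLpNorm_of_ae_le_mul (Eventually.of_forall fun x => ?_) 2
    rw [Pi.smul_apply', norm_smul]
    exact mul_le_mul_of_nonneg_right (hL _) (norm_nonneg _)

theorem IsH10.neg {u : RN N → ℝ} {Du : RN N → RN N} (h : IsH10 Ω u Du) :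
    IsH10 Ω (fun x => -u x) (fun x => -Du x) := by
  have := h.comp (β := fun t => -t) contDiff_neg (by simp) (L := 1) (by simp)
  simpa using this

/-- The derivative of `Real.smoothTransition` is continuous and supported in `[0, 1]`. -/
theorem exists_abs_deriv_smoothTransition_le :
    ∃ L, ∀ t, |deriv Real.smoothTransition t| ≤ L := by
  have hc : Continuous (deriv Real.smoothTransition) :=
    (Real.smoothTransition.contDiff (n := 1)).continuous_deriv (by simp)
  have hs : HasCompactSupport (deriv Real.smoothTransition) := by
    refine HasCompactSupport.intro (isCompact_Icc (a := (0 : ℝ)) (b := 1)) fun t ht => ?_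
    rw [mem_Icc, not_and_or, not_le, not_le] at ht
    rcases ht with ht | ht
    · have : Real.smoothTransition =ᶠ[𝓝 t] fun _ => 0 := by
        filter_upwards [Iio_mem_nhds ht] with s hs
        exact Real.smoothTransition.zero_of_nonpos (le_of_lt hs)
      rw [this.deriv_eq]; simp
    · have : Real.smoothTransition =ᶠ[𝓝 t] fun _ => 1 := by
        filter_upwards [Ioi_mem_nhds ht] with s hs
        exact Real.smoothTransition.one_of_one_le (le_of_lt hs)
      rw [this.deriv_eq]; simp
  exact hs.exists_bound_of_continuous hc

theorem deriv_smoothTransition_nonneg (t : ℝ) : 0 ≤ deriv Real.smoothTransition t :=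
  Monotone.deriv_nonneg Real.smoothTransition.monotone

/-! ### Minimizers of the energy and the Euler–Lagrange equation -/

section Growth

variable {k : ℝ → ℝ}

/-- A continuous function that vanishes on the negative axis and is `o(t)` at `+∞` is, up to a
constant, smaller than any multiple of `|t|`. -/
theorem exists_abs_le_mul_add (hk : Continuous k) (hk0 : ∀ t ≤ 0, k t = 0)
    (hko : k =o[atTop] fun t : ℝ => t) {ε : ℝ} (hε : 0 < ε) :
    ∃ C, 0 ≤ C ∧ ∀ t, |k t| ≤ ε * |t| + C := by
  obtain ⟨T, hT⟩ := eventually_atTop.1 (hko.def hε)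
  obtain ⟨C, hC⟩ := (isCompact_Icc (a := (0 : ℝ)) (b := T)).exists_bound_of_continuousOn
    hk.continuousOn
  refine ⟨max C 0, le_max_right _ _, fun t => ?_⟩
  have h0 : 0 ≤ ε * |t| := by positivity
  rcases le_total t 0 with h | h
  · rw [hk0 t h, abs_zero]
    exact add_nonneg h0 (le_max_right _ _)
  rcases le_total T t with h' | h'
  · have := hT t h'
    simp only [Real.norm_eq_abs] at this
    linarith [le_max_right C 0]
  · have := hC t ⟨h, h'⟩
    simp only [Real.norm_eq_abs] at this
    linarith [le_max_left C 0]

/-- The quadratic upper bound for the primitive that yields coercivity of the energy. -/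
theorem exists_primitive_le (hk : Continuous k) (hk0 : ∀ t ≤ 0, k t = 0)
    (hko : k =o[atTop] fun t : ℝ => t) {ε : ℝ} (hε : 0 < ε) :
    ∃ C, ∀ t, primitive k t ≤ ε * t ^ 2 + C := by
  obtain ⟨C, hC0, hC⟩ := exists_abs_le_mul_add hk hk0 hko (half_pos hε)
  refine ⟨C ^ 2 / (2 * ε), fun t => ?_⟩
  have h1 : ‖∫ s in (0 : ℝ)..t, k s‖ ≤ (ε / 2 * |t| + C) * |t - 0| := by
    refine intervalIntegral.norm_integral_le_of_norm_le_const fun s hs => ?_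
    have hst : |s| ≤ |t| := by
      rcases mem_uIoc.1 hs with h | h
      · rw [abs_of_pos h.1, abs_of_pos (h.1.trans_le h.2)]; exact h.2
      · rw [abs_of_nonpos h.2, abs_of_nonpos (h.1.le.trans h.2)]; linarith
    refine (hC s).trans ?_
    gcongr
  rw [sub_zero] at h1
  have h2 : primitive k t ≤ (ε / 2 * |t| + C) * |t| := (le_abs_self _).trans h1
  have h3 : C * |t| ≤ ε / 2 * |t| ^ 2 + C ^ 2 / (2 * ε) := by
    have h4 : ε / 2 * |t| ^ 2 + C ^ 2 / (2 * ε) - C * |t| = (ε * |t| - C) ^ 2 / (2 * ε) := by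
      field_simp; ring
    have : 0 ≤ (ε * |t| - C) ^ 2 / (2 * ε) := by positivity
    linarith
  rw [← sq_abs t]
  nlinarith

end Growth

/-- The energy `∫ Γ((w² + |∇w|²)/2) - ∫ F(w) - ∫ h w`, where `Γ`, `F` are the primitives of `γ`
and `k`, without truncation of `w`. -/
def totalEnergy (Ω : Set (RN N)) (γ k : ℝ → ℝ) (h : RN N → ℝ)
    (w : RN N → ℝ) (Dw : RN N → RN N) : ℝ :=
  (∫ x in Ω, primitive γ (‖jet w Dw x‖ ^ 2 / 2)) - (∫ x in Ω, primitive k (w x))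
    - ∫ x in Ω, h x * w x

theorem IsH10.add_smul {u v : RN N → ℝ} {Du Dv : RN N → RN N} (hu : IsH10 Ω u Du)
    (hv : IsH10 Ω v Dv) (t : ℝ) :
    IsH10 Ω (fun x => u x + t • v x) (fun x => Du x + t • Dv x) := by
  refine isH10_of_mem_sobolevJets
    ((sobolevJets Ω).add_mem hu.toLp_mem ((sobolevJets Ω).smul_mem t hv.toLp_mem)) ?_
  filter_upwards [Lp.coeFn_add hu.memLp_jet.toLp (t • hv.memLp_jet.toLp),
    Lp.coeFn_smul t hv.memLp_jet.toLp, hu.memLp_jet.coeFn_toLp, hv.memLp_jet.coeFn_toLp]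
    with x h1 h2 h3 h4
  rw [h1, Pi.add_apply, h2, Pi.smul_apply, h3, h4]
  rfl

section Minimization

variable {γ k : ℝ → ℝ} {γmin γmax : ℝ} {h : RN N → ℝ}

/-- The energy attains its minimum on `H^1_0`: it is the sum of a continuous convex functional `J₁`
on `L²(Ω; ℝ × ℝ^N)` and a functional `J₂` that is weakly continuous by Rellich's theorem. -/
theorem exists_isMinimizer_totalEnergy [IsFiniteMeasure (volume.restrict Ω)]
    (hγc : Continuous γ) (hγmin : 0 < γmin)
    (hγ : ∀ t, γmin ≤ γ t ∧ γ t ≤ γmax)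
    (hΓ : ConvexOn ℝ (Ici 0) fun t : ℝ => primitive γ (t ^ 2))
    (hk : Continuous k) (hk0 : ∀ t ≤ 0, k t = 0) (hko : k =o[atTop] fun t : ℝ => t)
    (hh : MemLp h 2 (volume.restrict Ω)) :
    ∃ u Du, IsH10 Ω u Du ∧ ∀ w Dw, IsH10 Ω w Dw →
      totalEnergy Ω γ k h u Du ≤ totalEnergy Ω γ k h w Dw := by
  have hγabs : ∀ t, |γ t| ≤ γmax := fun t =>
    abs_le.2 ⟨by linarith [hγ t], (hγ t).2⟩
  obtain ⟨C₁, hC₁, hkC⟩ := exists_abs_le_mul_add hk hk0 hko one_pos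
  have hkg := linearGrowthDeriv_primitive hk (C := 1 + C₁) (by positivity) fun t => by
    nlinarith [hkC t, abs_nonneg t]
  have hΓg := linearGrowthDeriv_norm_sq (H := Jet N) hγc hγabs
  set J₁ : JetL2 Ω → ℝ := fun U => ∫ x in Ω, primitive γ (‖U x‖ ^ 2 / 2) with hJ₁
  set J₂ : JetL2 Ω → ℝ := fun U =>
    -(∫ x in Ω, primitive k (fstL2 Ω U x)) - inner ℝ hh.toLp (fstL2 Ω U) with hJ₂
  have hJ₂' : ∀ U : JetL2 Ω, J₂ U = -(∫ x in Ω, primitive k (U x).fst)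
      - ∫ x in Ω, h x * (U x).fst := by
    intro U
    simp only [hJ₂]
    congr 1
    · congr 1
      refine integral_congr_ae ?_
      filter_upwards [coeFn_fstL2 U] with x hx
      rw [hx]
    · rw [L2.inner_def]
      refine integral_congr_ae ?_
      filter_upwards [coeFn_fstL2 U, hh.coeFn_toLp] with x hx hx'
      rw [hx, hx']
      simp [mul_comm]
  have hJ : ∀ (U : JetL2 Ω) (w : RN N → ℝ) (Dw : RN N → RN N),
      U =ᵐ[volume.restrict Ω] jet w Dw → J₁ U + J₂ U = totalEnergy Ω γ k h w Dw := by
    intro U w Dw hU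
    rw [hJ₂', totalEnergy, hJ₁]
    have e1 : ∫ x in Ω, primitive γ (‖U x‖ ^ 2 / 2)
        = ∫ x in Ω, primitive γ (‖jet w Dw x‖ ^ 2 / 2) :=
      integral_congr_ae (hU.mono fun x hx => by simp only [hx])
    have e2 : ∫ x in Ω, primitive k (U x).fst = ∫ x in Ω, primitive k (w x) :=
      integral_congr_ae (hU.mono fun x hx => by simp only [hx, jet_fst])
    have e3 : ∫ x in Ω, h x * (U x).fst = ∫ x in Ω, h x * w x :=
      integral_congr_ae (hU.mono fun x hx => by simp only [hx, jet_fst])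
    dsimp only
    rw [e1, e2, e3]
    ring
  -- With `ε = γmin / 8` both lower order terms are absorbed by half of the principal part.
  have hε : 0 < γmin / 8 := by positivity
  obtain ⟨C₂, hC₂⟩ := exists_primitive_le hk hk0 hko hε
  have hcoer : ∀ U ∈ (sobolevJets Ω : Set (JetL2 Ω)), γmin / 4 * ‖U‖ ^ 2
      - (∫ x in Ω, (C₂ + 2 / γmin * h x ^ 2)) ≤ J₁ U + J₂ U := by
    intro U _
    have hUm := Lp.memLp U
    have iU : Integrable (fun x => ‖U x‖ ^ 2) (volume.restrict Ω) := hUm.integrable_norm_pow (by simp)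
    have i1 := hΓg.integrable_comp hUm
    have i2 := hkg.integrable_comp hUm.prodLp_fst
    have i3 := integrable_mul_of_memLp_two hh hUm.prodLp_fst
    have i4 : Integrable (fun x => C₂ + 2 / γmin * h x ^ 2) (volume.restrict Ω) :=
      (integrable_const _).add (hh.integrable_sq.const_mul _)
    have e : ‖U‖ ^ 2 = ∫ x in Ω, ‖U x‖ ^ 2 := by
      rw [← real_inner_self_eq_norm_sq, L2.inner_def]
      simp_rw [real_inner_self_eq_norm_sq]
    rw [hJ₂', hJ₁, e, ← integral_const_mul, ← integral_sub (iU.const_mul _) i4]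
    have e' : (∫ x in Ω, primitive γ (‖U x‖ ^ 2 / 2)) +
        (-(∫ x in Ω, primitive k (U x).fst) - ∫ x in Ω, h x * (U x).fst)
        = ∫ x in Ω, (primitive γ (‖U x‖ ^ 2 / 2) - primitive k (U x).fst - h x * (U x).fst) := by
      have i12 : Integrable (fun x => primitive γ (‖U x‖ ^ 2 / 2) - primitive k (U x).fst)
          (volume.restrict Ω) := i1.sub i2
      rw [integral_sub i12 i3, integral_sub i1 i2]; ring
    dsimp only
    rw [e']
    refine integral_mono ((iU.const_mul _).sub i4) ((i1.sub i2).sub i3) fun x => ?_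
    dsimp only
    have b1 := mul_le_primitive hγc (fun t => (hγ t).1) (t := ‖U x‖ ^ 2 / 2) (by positivity)
    have b2 := hC₂ (U x).fst
    have b3 : h x * (U x).fst ≤ γmin / 8 * (U x).fst ^ 2 + 2 / γmin * h x ^ 2 := by
      have : γmin / 8 * (U x).fst ^ 2 + 2 / γmin * h x ^ 2 - h x * (U x).fst
          = (γmin * (U x).fst - 4 * h x) ^ 2 / (8 * γmin) := by
        field_simp; ring
      have h2 : 0 ≤ (γmin * (U x).fst - 4 * h x) ^ 2 / (8 * γmin) := by positivity
      linarith
    have b4 : (U x).fst ^ 2 ≤ ‖U x‖ ^ 2 := by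
      rw [Jet.norm_sq_eq]; linarith [sq_nonneg ‖(U x).snd‖]
    nlinarith
  obtain ⟨U, hU, hmin⟩ := exists_minimizer (K := (sobolevJets Ω : Set (JetL2 Ω)))
    (sobolevJets Ω).convex (testJets Ω).isClosed_topologicalClosure ⟨0, (sobolevJets Ω).zero_mem⟩
    (J₁ := J₁) (J₂ := J₂)
    (hΓg.convexOn_integral (convexOn_primitive_norm_sq hγc
      (fun t => hγmin.le.trans (hγ t).1) hΓ)) hΓg.continuous_integral
    (fun u l M huK hM hw hl => by
      have h1 := tendsto_fstL2 huK hl hM hw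
      have h2 := (hkg.continuous_integral (μ := volume.restrict Ω)).tendsto (fstL2 Ω l)
      exact (h2.comp h1).neg.sub (tendsto_const_nhds.inner h1))
    (by positivity : 0 < γmin / 4) hcoer
  have hUj : U =ᵐ[volume.restrict Ω] jet (fun x => (U x).fst) (fun x => (U x).snd) :=
    Eventually.of_forall fun x => rfl
  refine ⟨_, _, isH10_of_mem_sobolevJets hU hUj, fun w Dw hw => ?_⟩
  rw [← hJ U _ _ hUj, ← hJ _ w Dw hw.memLp_jet.coeFn_toLp]
  exact hmin _ hw.toLp_mem

theorem operatorDensity_eq_inner (γ : ℝ → ℝ) (u : RN N → ℝ) (Du : RN N → RN N)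
    (v : RN N → ℝ) (Dv : RN N → RN N) (x : RN N) :
    operatorDensity γ u Du v Dv x =
      (γ (‖jet u Du x‖ ^ 2 / 2) • innerSL ℝ (jet u Du x)) (jet v Dv x) := by
  rw [smul_apply, innerSL_apply_apply, Jet.inner_eq, Jet.norm_sq_eq]
  rfl

/-- The Euler–Lagrange equation of the energy. -/
theorem euler_lagrange [IsFiniteMeasure (volume.restrict Ω)]
    (hγc : Continuous γ) (hγ : ∀ t, |γ t| ≤ γmax)
    (hk : Continuous k) {C : ℝ} (hkC : ∀ t, |k t| ≤ C * (1 + |t|)) (hC : 0 ≤ C)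
    (hh : MemLp h 2 (volume.restrict Ω))
    {u : RN N → ℝ} {Du : RN N → RN N} (hu : IsH10 Ω u Du)
    (hmin : ∀ w Dw, IsH10 Ω w Dw → totalEnergy Ω γ k h u Du ≤ totalEnergy Ω γ k h w Dw)
    {v : RN N → ℝ} {Dv : RN N → RN N} (hv : IsH10 Ω v Dv) :
    IntegrableOn (operatorDensity γ u Du v Dv) Ω ∧ IntegrableOn (fun x => k (u x) * v x) Ω ∧
      IntegrableOn (fun x => h x * v x) Ω ∧
      ∫ x in Ω, operatorDensity γ u Du v Dv x
        = (∫ x in Ω, k (u x) * v x) + ∫ x in Ω, h x * v x := by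
  obtain ⟨i1, d1⟩ := (linearGrowthDeriv_norm_sq (H := Jet N) hγc hγ).hasDerivAt_integral
    hu.memLp_jet hv.memLp_jet
  obtain ⟨i2, d2⟩ := (linearGrowthDeriv_primitive hk hC hkC).hasDerivAt_integral hu.memLp hv.memLp
  simp_rw [← operatorDensity_eq_inner] at i1 d1
  have i2' : Integrable (fun x => k (u x) * v x) (volume.restrict Ω) := by
    simpa [mul_comm] using i2
  have e2 : ∫ x in Ω, (ContinuousLinearMap.toSpanSingleton ℝ (k (u x))) (v x)
      = ∫ x in Ω, k (u x) * v x := by simp [mul_comm]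
  rw [e2] at d2
  have ihu := integrable_mul_of_memLp_two hh hu.memLp
  have ihv := integrable_mul_of_memLp_two hh hv.memLp
  have d3 : HasDerivAt (fun t : ℝ => ∫ x in Ω, h x * (u x + t • v x)) (∫ x in Ω, h x * v x) 0 := by
    have e3 : ∀ t : ℝ, ∫ x in Ω, h x * (u x + t • v x)
        = (∫ x in Ω, h x * u x) + t * ∫ x in Ω, h x * v x := by
      intro t
      rw [← integral_const_mul, ← integral_add ihu (ihv.const_mul t)]
      congr 1 with x
      rw [smul_eq_mul]
      ring
    simp_rw [e3]
    simpa using ((hasDerivAt_id (0 : ℝ)).mul_const (∫ x in Ω, h x * v x)).const_add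
      (∫ x in Ω, h x * u x)
  have hd := (d1.sub d2).sub d3
  have hloc : IsLocalMin (fun t : ℝ => totalEnergy Ω γ k h (fun x => u x + t • v x)
      (fun x => Du x + t • Dv x)) 0 := by
    refine Eventually.of_forall fun t => ?_
    simpa using hmin _ _ (hu.add_smul hv t)
  have h0 := hloc.hasDerivAt_eq_zero hd
  exact ⟨i1, i2', ihv, by linarith⟩

/-- Solutions are non-negative: for a smooth non-decreasing `β` that vanishes exactly on `(-∞, 0]`,
testing with `β(-u)` makes the left-hand side non-positive and the right-hand side non-negative,
so that `u β(-u) = 0` almost everywhere. -/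
theorem nonneg_of_euler_lagrange (hγmin : 0 < γmin) (hγ : ∀ t, γmin ≤ γ t)
    (hk0 : ∀ t ≤ 0, k t = 0) (hhn : ∀ᵐ x ∂(volume.restrict Ω), 0 ≤ h x)
    {u : RN N → ℝ} {Du : RN N → RN N} (hu : IsH10 Ω u Du)
    (heq : ∀ v Dv, IsH10 Ω v Dv → IntegrableOn (operatorDensity γ u Du v Dv) Ω ∧
      ∫ x in Ω, operatorDensity γ u Du v Dv x
        = (∫ x in Ω, k (u x) * v x) + ∫ x in Ω, h x * v x) :
    ∀ᵐ x ∂(volume.restrict Ω), 0 ≤ u x := by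
  obtain ⟨L, hL⟩ := exists_abs_deriv_smoothTransition_le
  set β := Real.smoothTransition with hβ
  have hv := hu.neg.comp (β := β) Real.smoothTransition.contDiff Real.smoothTransition.zero hL
  obtain ⟨hi, he⟩ := heq _ _ hv
  have e1 : ∫ x in Ω, k (u x) * β (-u x) = 0 := by
    rw [← integral_zero (RN N) ℝ (μ := volume.restrict Ω)]
    congr 1 with x
    rcases le_total (u x) 0 with hx | hx
    · rw [hk0 _ hx, zero_mul]
    · rw [hβ, Real.smoothTransition.zero_of_nonpos (neg_nonpos.2 hx), mul_zero]
  have e2 : 0 ≤ ∫ x in Ω, h x * β (-u x) :=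
    integral_nonneg_of_ae (hhn.mono fun x hx => mul_nonneg hx (Real.smoothTransition.nonneg _))
  have hub : ∀ x, u x * β (-u x) ≤ 0 := by
    intro x
    rcases le_total (u x) 0 with hx | hx
    · exact mul_nonpos_of_nonpos_of_nonneg hx (Real.smoothTransition.nonneg _)
    · rw [hβ, Real.smoothTransition.zero_of_nonpos (neg_nonpos.2 hx), mul_zero]
  have hle : ∀ x, operatorDensity γ u Du (fun x => β (-u x))
      (fun x => deriv β (-u x) • -Du x) x ≤ γmin * (u x * β (-u x)) := by
    intro x
    rw [operatorDensity, inner_smul_right, inner_neg_right, real_inner_self_eq_norm_sq]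
    have h1 := mul_nonneg (deriv_smoothTransition_nonneg (-u x)) (sq_nonneg ‖Du x‖)
    have h2 := hγ ((u x ^ 2 + ‖Du x‖ ^ 2) / 2)
    have h3 := hub x
    calc _ ≤ γ ((u x ^ 2 + ‖Du x‖ ^ 2) / 2) * (u x * β (-u x)) :=
          mul_le_mul_of_nonneg_left (by simp only [hβ] at h1 ⊢; linarith) (hγmin.le.trans h2)
      _ ≤ _ := mul_le_mul_of_nonpos_right h2 h3
  have hnp : ∀ x, operatorDensity γ u Du (fun x => β (-u x))
      (fun x => deriv β (-u x) • -Du x) x ≤ 0 := fun x =>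
    (hle x).trans (mul_nonpos_of_nonneg_of_nonpos hγmin.le (hub x))
  have hz := (integral_eq_zero_iff_of_nonneg (fun x => neg_nonneg.2 (hnp x)) hi.neg).1 (by
    refine le_antisymm ?_ (integral_nonneg fun x => neg_nonneg.2 (hnp x))
    rw [integral_neg]
    linarith)
  filter_upwards [hz] with x hx
  by_contra hux
  rw [not_le] at hux
  have h1 : 0 < β (-u x) := Real.smoothTransition.pos_of_pos (by linarith)
  have h2 := hle x
  simp only [Pi.zero_apply] at hx
  have h3 : u x * β (-u x) < 0 := mul_neg_of_neg_of_pos hux h1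
  nlinarith

end Minimization

/-! ### Weak solutions and their nontriviality -/

theorem primitive_comp_max {k : ℝ → ℝ} (hk0 : k 0 = 0) (t : ℝ) :
    primitive (fun s => k (max s 0)) t = primitive k (max t 0) := by
  rcases le_total t 0 with h | h
  · rw [max_eq_right h, primitive_zero, primitive]
    rw [intervalIntegral.integral_congr (g := fun _ => (0 : ℝ)) fun s hs => ?_]
    · simp
    · rw [uIcc_of_ge h] at hs
      simp only [max_eq_right hs.2, hk0]
  · rw [max_eq_left h, primitive, primitive]
    refine intervalIntegral.integral_congr fun s hs => ?_
    rw [uIcc_of_le h] at hs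
    simp only [max_eq_left hs.1]

theorem primitive_comp_max_of_nonneg (k : ℝ → ℝ) {t : ℝ} (h : 0 ≤ t) :
    primitive (fun s => k (max s 0)) t = primitive k t := by
  refine intervalIntegral.integral_congr fun s hs => ?_
  rw [uIcc_of_le h] at hs
  simp only [max_eq_left hs.1]

theorem primitive_const_mul (c : ℝ) (k : ℝ → ℝ) (t : ℝ) :
    primitive (fun s => c * k s) t = c * primitive k t :=
  intervalIntegral.integral_const_mul _ _

theorem operatorDensity_comp_max (γ : ℝ → ℝ) (u : RN N → ℝ) (Du : RN N → RN N)
    (v : RN N → ℝ) (Dv : RN N → RN N) :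
    operatorDensity (fun s => γ (max s 0)) u Du v Dv = operatorDensity γ u Du v Dv := by
  funext x
  simp only [operatorDensity]
  rw [max_eq_left (by positivity)]

/-- For truncated coefficients the untruncated energy is the one with `max w 0` in the lower order
term. -/
theorem totalEnergy_comp_max (γ : ℝ → ℝ) {k : ℝ → ℝ} (hk0 : k 0 = 0) (h : RN N → ℝ)
    (u : RN N → ℝ) (Du : RN N → RN N) :
    totalEnergy Ω (fun s => γ (max s 0)) (fun s => k (max s 0)) h u Du = energy Ω γ k h u Du := by
  simp only [totalEnergy, energy, primitive_comp_max hk0]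
  congr 3 with x
  rw [primitive_comp_max_of_nonneg _ (by positivity), Jet.norm_sq_eq]
  rfl

/-- Existence of a non-negative weak solution that globally minimizes the energy. -/
theorem exists_nonneg_weakSolution [IsFiniteMeasure (volume.restrict Ω)]
    {γ f : ℝ → ℝ} {γmin γmax : ℝ} {h : RN N → ℝ} (hγc : ContinuousOn γ (Ici 0))
    (hγmin : 0 < γmin) (hγ : ∀ t : ℝ, 0 ≤ t → γmin ≤ γ t ∧ γ t ≤ γmax)
    (hΓ : ConvexOn ℝ (Ici 0) fun t : ℝ => primitive γ (t ^ 2))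
    (hf : Continuous f) (hf0 : f 0 = 0) (hfo : f =o[atTop] fun t : ℝ => t)
    (hh : MemLp h 2 (volume.restrict Ω)) (hhn : ∀ᵐ x ∂(volume.restrict Ω), 0 ≤ h x) :
    ∃ u, IsWeakSolution Ω γ f h u ∧ IsGlobalMinimizer Ω γ f h u ∧
      ∀ᵐ x ∂(volume.restrict Ω), 0 ≤ u x := by
  set γ' : ℝ → ℝ := fun s => γ (max s 0) with hγ'
  set k : ℝ → ℝ := fun s => f (max s 0) with hk
  have hγ'c : Continuous γ' :=
    hγc.comp_continuous (by fun_prop) fun s => mem_Ici.2 (le_max_right _ _)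
  have hγ'b : ∀ t, γmin ≤ γ' t ∧ γ' t ≤ γmax := fun t => hγ _ (le_max_right _ _)
  have hkc : Continuous k := hf.comp (by fun_prop)
  have hk0 : ∀ t ≤ 0, k t = 0 := fun t ht => by simp only [hk, max_eq_right ht, hf0]
  have hko : k =o[atTop] fun t : ℝ => t := by
    refine hfo.congr' ?_ EventuallyEq.rfl
    filter_upwards [eventually_ge_atTop 0] with t ht
    simp only [hk, max_eq_left ht]
  have hΓ' : ConvexOn ℝ (Ici 0) fun t : ℝ => primitive γ' (t ^ 2) :=
    hΓ.congr fun t _ => (primitive_comp_max_of_nonneg γ (sq_nonneg t)).symm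
  obtain ⟨u, Du, hu, hmin⟩ :=
    exists_isMinimizer_totalEnergy hγ'c hγmin hγ'b hΓ' hkc hk0 hko hh
  obtain ⟨C, hC0, hC⟩ := exists_abs_le_mul_add hkc hk0 hko one_pos
  have hEL := fun v Dv (hv : IsH10 Ω v Dv) => euler_lagrange hγ'c
    (fun t => abs_le.2 ⟨by linarith [hγ'b t], (hγ'b t).2⟩) hkc (C := 1 + C)
    (fun t => by nlinarith [hC t, abs_nonneg t]) (by positivity) hh hu hmin hv
  have hpos := nonneg_of_euler_lagrange hγmin (fun t => (hγ'b t).1) hk0 hhn hu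
    fun v Dv hv => ⟨(hEL v Dv hv).1, (hEL v Dv hv).2.2.2⟩
  have hkf : ∀ v : RN N → ℝ,
      (fun x => k (u x) * v x) =ᵐ[volume.restrict Ω] fun x => f (u x) * v x := fun v =>
    hpos.mono fun x hx => by simp only [hk, max_eq_left hx]
  refine ⟨u, ⟨Du, hu, fun v Dv hv => ?_⟩, ⟨Du, hu, fun w Dw hw => ?_⟩, hpos⟩
  · obtain ⟨h1, h2, h3, h4⟩ := hEL v Dv hv
    rw [hγ', operatorDensity_comp_max] at h1 h4
    exact ⟨h1, (integrable_congr (hkf v)).1 h2, h3, by rw [h4, integral_congr_ae (hkf v)]⟩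
  · simpa only [hγ', hk, totalEnergy_comp_max _ hf0] using hmin w Dw hw

/-- Coercivity of the operator. -/
theorem mul_le_operatorDensity_self {γ : ℝ → ℝ} {γmin : ℝ} (hγ : ∀ t : ℝ, 0 ≤ t → γmin ≤ γ t)
    (u : RN N → ℝ) (Du : RN N → RN N) (x : RN N) :
    γmin * (u x ^ 2 + ‖Du x‖ ^ 2) ≤ operatorDensity γ u Du u Du x := by
  rw [operatorDensity, real_inner_self_eq_norm_sq, ← sq]
  exact mul_le_mul_of_nonneg_right (hγ _ (by positivity)) (by positivity)

/-- The zero function solves the equation only for a vanishing right-hand side. -/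
theorem IsWeakSolution.ae_eq_zero_of_ae_eq_zero [IsFiniteMeasure (volume.restrict Ω)]
    (hΩ : IsOpen Ω) {γ f : ℝ → ℝ} {γmin : ℝ}
    {h : RN N → ℝ} (hγmin : 0 < γmin) (hγ : ∀ t : ℝ, 0 ≤ t → γmin ≤ γ t) (hf0 : f 0 = 0)
    (hh : MemLp h 2 (volume.restrict Ω)) {u : RN N → ℝ} (hu : IsWeakSolution Ω γ f h u)
    (hu0 : ∀ᵐ x ∂(volume.restrict Ω), u x = 0) : ∀ᵐ x ∂(volume.restrict Ω), h x = 0 := by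
  obtain ⟨Du, hu1, hsol⟩ := hu
  have hfz : ∀ v : RN N → ℝ, ∫ x in Ω, f (u x) * v x = 0 := fun v =>
    integral_eq_zero_of_ae (hu0.mono fun x hx => by simp [hx, hf0])
  have hDu : ∀ᵐ x ∂(volume.restrict Ω), Du x = 0 := by
    obtain ⟨i1, -, -, he⟩ := hsol u Du hu1
    rw [hfz, zero_add, integral_eq_zero_of_ae (f := fun x => h x * u x)
      (hu0.mono fun x hx => by simp [hx])] at he
    have hle := mul_le_operatorDensity_self hγ u Du
    have h0 : ∀ x, 0 ≤ operatorDensity γ u Du u Du x := fun x =>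
      le_trans (by positivity) (hle x)
    have hz := (integral_eq_zero_iff_of_nonneg h0 i1).1 he
    filter_upwards [hz] with x hx
    have h1 := hle x
    rw [hx, Pi.zero_apply] at h1
    have h2 : ‖Du x‖ ^ 2 ≤ 0 := by
      have := nonpos_of_mul_nonpos_right h1 hγmin
      nlinarith [sq_nonneg (u x)]
    have h3 : ‖Du x‖ = 0 := pow_eq_zero_iff (two_ne_zero) |>.1 (le_antisymm h2 (sq_nonneg _))
    exact norm_eq_zero.1 h3
  rw [ae_restrict_iff' hΩ.measurableSet]
  refine hΩ.ae_eq_zero_of_integral_contDiff_smul_eq_zero ?_ fun ψ h1 h2 h3 => ?_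
  · exact IntegrableOn.locallyIntegrableOn (hh.integrable (by norm_num))
  · have hψ : IsTest Ω ψ := ⟨h1, h2, h3⟩
    obtain ⟨-, -, -, he⟩ := hsol ψ _ hψ.isH10
    rw [hfz, zero_add, integral_eq_zero_of_ae] at he
    · rw [← setIntegral_eq_integral_of_forall_compl_eq_zero (s := Ω)
        (fun x hx => by simp [hψ.eq_zero_of_notMem hx])]
      simp_rw [smul_eq_mul, mul_comm (ψ _)]
      exact he.symm
    · filter_upwards [hu0, hDu] with x h4 h5
      simp [operatorDensity, h4, h5]

/-- `∫ G(φ) > 0` for a test function `φ` with values in `[0, t₀]` that equals `t₀` on most of `Ω`. -/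
theorem exists_isTest_integral_primitive_pos (hΩ : IsOpen Ω) (hne : Ω.Nonempty)
    [IsFiniteMeasure (volume.restrict Ω)] {g : ℝ → ℝ} (hg : Continuous g) {t₀ : ℝ} (ht₀ : 0 ≤ t₀)
    (hG : 0 < primitive g t₀) :
    ∃ φ, IsTest Ω φ ∧ (∀ x, 0 ≤ φ x) ∧ 0 < ∫ x in Ω, primitive g (φ x) := by
  obtain ⟨M, hM⟩ := (isCompact_Icc (a := (0 : ℝ)) (b := t₀)).exists_bound_of_continuousOn
    (continuous_primitive hg).continuousOn
  have hM0 : 0 ≤ M := (norm_nonneg _).trans (hM 0 ⟨le_rfl, ht₀⟩)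
  set a := primitive g t₀ with ha
  set m := volume.real Ω with hm
  have hfin : volume Ω ≠ ⊤ := by
    have := measure_ne_top (volume.restrict Ω) univ
    rwa [Measure.restrict_apply_univ] at this
  have hmpos : 0 < m := ENNReal.toReal_pos (hΩ.measure_pos _ hne).ne' hfin
  -- A compact `K ⊆ Ω` so large that `G(t₀) |K|` beats the largest possible loss `M |Ω \ K|`.
  obtain ⟨K, hKΩ, hK, hKm⟩ := hΩ.exists_lt_isCompact (μ := volume)
    (r := ENNReal.ofReal (M * m / (a + M))) (by
      rw [← ENNReal.ofReal_toReal hfin]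
      refine (ENNReal.ofReal_lt_ofReal_iff hmpos).2 ?_
      rw [div_lt_iff₀ (by positivity)]
      change M * m < m * (a + M)
      nlinarith)
  have hKfin : volume K ≠ ⊤ := hK.measure_ne_top
  have hK' : M * m < (a + M) * volume.real K := by
    rw [← ENNReal.ofReal_toReal hKfin, ENNReal.ofReal_lt_ofReal_iff_of_nonneg (by positivity),
      div_lt_iff₀ (by positivity)] at hKm
    rw [mul_comm (a + M)]
    exact hKm
  obtain ⟨V, hVo, hKV, hVΩ, hVc⟩ := exists_open_between_and_isCompact_closure hK hΩ hKΩ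
  obtain ⟨χ, hχs, hχr, hχV, hχK⟩ := exists_contMDiff_support_eq_eq_one_iff (n := ⊤)
    (modelWithCornersSelf ℝ (RN N)) hVo hK.isClosed hKV
  have hχ : IsTest Ω χ := ⟨hχs.contDiff, by rwa [HasCompactSupport, tsupport, hχV],
    by rwa [tsupport, hχV]⟩
  have hχ01 : ∀ x, χ x ∈ Icc (0 : ℝ) 1 := fun x => hχr (mem_range_self x)
  refine ⟨_, hχ.const_mul t₀, fun x => mul_nonneg ht₀ (hχ01 x).1, ?_⟩
  have hmem : ∀ x, t₀ * χ x ∈ Icc 0 t₀ := fun x =>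
    ⟨mul_nonneg ht₀ (hχ01 x).1, mul_le_of_le_one_right ht₀ (hχ01 x).2⟩
  have hle : ∀ x, K.indicator (fun _ => a + M) x - M ≤ primitive g (t₀ * χ x) := by
    intro x
    by_cases hx : x ∈ K
    · rw [indicator_of_mem hx, (hχK x).1 hx, mul_one]; linarith
    · rw [indicator_of_notMem hx]
      have := neg_le_of_abs_le (hM _ (hmem x))
      linarith
  have i1 : Integrable (fun x => primitive g (t₀ * χ x)) (volume.restrict Ω) :=
    Integrable.of_bound (C := M) (((continuous_primitive hg).comp
      (continuous_const.mul hχ.continuous)).aestronglyMeasurable)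
      (Eventually.of_forall fun x => hM _ (hmem x))
  have i2 : Integrable (K.indicator fun _ => a + M) (volume.restrict Ω) :=
    (integrable_const _).indicator hK.measurableSet
  calc (0 : ℝ) < (a + M) * volume.real K - M * m := by linarith
    _ = ∫ x in Ω, (K.indicator (fun _ => a + M) x - M) := by
        rw [integral_sub i2 (integrable_const _), integral_indicator_const _ hK.measurableSet,
          integral_const, measureReal_restrict_apply hK.measurableSet,
          inter_eq_self_of_subset_left hKΩ, measureReal_restrict_apply_univ]
        simp only [smul_eq_mul]
        ring
    _ ≤ _ := integral_mono (i2.sub (integrable_const _)) i1 hle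

end Quasilinear

end

theorem theorem1 (N : ℕ) (hN : 1 ≤ N) (Ω : Set (Quasilinear.RN N))
    (hΩo : IsOpen Ω) (hΩb : Bornology.IsBounded Ω) (hΩne : Ω.Nonempty)
    (γ : ℝ → ℝ) (γmin γmax : ℝ) (hγc : ContinuousOn γ (Set.Ici 0)) (hγmin : 0 < γmin)
    (hγ : ∀ t : ℝ, 0 ≤ t → γmin ≤ γ t ∧ γ t ≤ γmax)
    (hΓ : ConvexOn ℝ (Set.Ici 0) (fun t : ℝ => Quasilinear.primitive γ (t ^ 2)))
    (g : ℝ → ℝ) (hgc : Continuous g) (hg0 : g 0 = 0)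
    (hg1 : g =o[Filter.atTop] (fun t : ℝ => t))
    (h : Quasilinear.RN N → ℝ)
    (hL2 : MeasureTheory.MemLp h 2 (MeasureTheory.volume.restrict Ω))
    (hnonneg : ∀ᵐ x ∂(MeasureTheory.volume.restrict Ω), 0 ≤ h x) :
    ((¬ ∀ᵐ x ∂(MeasureTheory.volume.restrict Ω), h x = 0) →
      ∀ ν : ℝ, 0 < ν → ∃ u : Quasilinear.RN N → ℝ,
        Quasilinear.IsWeakSolution Ω γ (fun t => ν * g t) h u ∧
        (∀ᵐ x ∂(MeasureTheory.volume.restrict Ω), 0 ≤ u x) ∧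
        ¬ ∀ᵐ x ∂(MeasureTheory.volume.restrict Ω), u x = 0) ∧
    ((∀ᵐ x ∂(MeasureTheory.volume.restrict Ω), h x = 0) →
      ((∃ t₀ : ℝ, 0 ≤ t₀ ∧ 0 < Quasilinear.primitive g t₀) →
        ∃ ν₁ : ℝ, 0 < ν₁ ∧ ∀ ν : ℝ, ν₁ < ν → ∃ u : Quasilinear.RN N → ℝ,
          Quasilinear.IsWeakSolution Ω γ (fun t => ν * g t) h u ∧
          Quasilinear.IsGlobalMinimizer Ω γ (fun t => ν * g t) h u ∧
          (∀ᵐ x ∂(MeasureTheory.volume.restrict Ω), 0 ≤ u x) ∧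
          ¬ ∀ᵐ x ∂(MeasureTheory.volume.restrict Ω), u x = 0) ∧
      ((∃ C : ℝ, 0 < C ∧ ∀ t : ℝ, |g t| ≤ C * |t|) →
        ∃ ν₀ : ℝ, 0 < ν₀ ∧ ∀ ν : ℝ, 0 < ν → ν < ν₀ → ∀ u : Quasilinear.RN N → ℝ,
          Quasilinear.IsWeakSolution Ω γ (fun t => ν * g t) h u →
          ∀ᵐ x ∂(MeasureTheory.volume.restrict Ω), u x = 0)) := by
  have hfin : IsFiniteMeasure (volume.restrict Ω) :=
    ⟨by rw [Measure.restrict_apply_univ]; exact hΩb.measure_lt_top⟩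
  have hex := fun ν : ℝ => Quasilinear.exists_nonneg_weakSolution (f := fun t => ν * g t) hγc hγmin
    hγ hΓ (continuous_const.mul hgc) (by simp [hg0]) (hg1.const_mul_left ν) hL2 hnonneg
  refine ⟨fun hh ν _ => ?_, fun hh => ⟨?_, ?_⟩⟩
  · obtain ⟨u, hu, -, hpos⟩ := hex ν
    exact ⟨u, hu, hpos, fun h0 => hh (hu.ae_eq_zero_of_ae_eq_zero hΩo hγmin
      (fun t ht => (hγ t ht).1) (by simp [hg0]) hL2 h0)⟩
  · rintro ⟨t₀, ht₀, hG⟩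
    obtain ⟨φ, hφ, hφ0, hφG⟩ :=
      Quasilinear.exists_isTest_integral_primitive_pos hΩo hΩne hgc ht₀ hG
    set A := ∫ x in Ω, Quasilinear.primitive γ ((φ x ^ 2 + ‖gradient φ x‖ ^ 2) / 2) with hA
    set B := ∫ x in Ω, Quasilinear.primitive g (φ x) with hB
    have hΓ0 : ∀ s : ℝ, 0 ≤ s → 0 ≤ Quasilinear.primitive γ s := fun s hs =>
      intervalIntegral.integral_nonneg hs fun r hr => hγmin.le.trans (hγ r hr.1).1
    have hA0 : 0 ≤ A := integral_nonneg fun x => hΓ0 _ (by positivity)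
    -- For `ν > A / B` the energy `A - ν B` of `φ` is negative.
    refine ⟨A / B + 1, by positivity, fun ν hν => ?_⟩
    obtain ⟨u, hu, hmin, hpos⟩ := hex ν
    refine ⟨u, hu, hmin, hpos, fun h0 => ?_⟩
    obtain ⟨Du, -, hle⟩ := hmin
    have hE := hle φ _ hφ.isH10
    have hhv : ∀ v : Quasilinear.RN N → ℝ, ∫ x in Ω, h x * v x = 0 := fun v =>
      integral_eq_zero_of_ae (hh.mono fun x hx => by simp [hx])
    have e1 : Quasilinear.energy Ω γ (fun t => ν * g t) h φ (gradient φ) = A - ν * B := by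
      simp only [Quasilinear.energy, hhv, Quasilinear.primitive_const_mul, max_eq_left (hφ0 _),
        integral_const_mul, sub_zero, hA, hB]
    have e2 : 0 ≤ Quasilinear.energy Ω γ (fun t => ν * g t) h u Du := by
      have e3 : ∫ x in Ω, Quasilinear.primitive (fun t => ν * g t) (max (u x) 0) = 0 :=
        integral_eq_zero_of_ae (h0.mono fun x hx => by
          simp [hx, Quasilinear.primitive_zero])
      rw [Quasilinear.energy, hhv, e3, sub_zero, sub_zero]
      exact integral_nonneg fun x => hΓ0 _ (by positivity)
    have h1 : A < ν * B := by
      rw [← div_lt_iff₀ hφG]; linarith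
    linarith
  · rintro ⟨C, hC, hgC⟩
    refine ⟨γmin / C, by positivity, fun ν hν hνC u ⟨Du, hu, hsol⟩ => ?_⟩
    obtain ⟨i1, i2, -, he⟩ := hsol u Du hu
    have hhu : ∫ x in Ω, h x * u x = 0 :=
      integral_eq_zero_of_ae (hh.mono fun x hx => by simp [hx])
    rw [hhu, add_zero, ← sub_eq_zero, ← integral_sub i1 i2] at he
    have hνC' : 0 < γmin - ν * C := by
      rw [lt_div_iff₀ hC] at hνC; linarith
    have hle : ∀ x, (γmin - ν * C) * u x ^ 2
        ≤ Quasilinear.operatorDensity γ u Du u Du x - ν * g (u x) * u x := by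
      intro x
      have h1 := Quasilinear.mul_le_operatorDensity_self (fun t ht => (hγ t ht).1) u Du x
      have h2 : g (u x) * u x ≤ C * u x ^ 2 := by
        rw [← sq_abs (u x), sq, ← mul_assoc]
        refine (le_abs_self _).trans ?_
        rw [abs_mul]
        exact mul_le_mul_of_nonneg_right (hgC _) (abs_nonneg _)
      have h3 := mul_le_mul_of_nonneg_left h2 hν.le
      have h4 : 0 ≤ γmin * ‖Du x‖ ^ 2 := by positivity
      linarith
    have hz := (integral_eq_zero_iff_of_nonneg
      (fun x => le_trans (by positivity) (hle x)) (i1.sub i2)).1 he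
    filter_upwards [hz] with x hx
    have h1 := hle x
    rw [hx, Pi.zero_apply] at h1
    have h2 := nonpos_of_mul_nonpos_right h1 hνC'
    exact pow_eq_zero_iff two_ne_zero |>.1 (le_antisymm h2 (sq_nonneg _))
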